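/- Let $V_\xi$ denote the levels of the cumulative hierarchy, and for a cardinal $\lambda$ let $H_\lambda$ be the set of all $x$ whose transitive closure has cardinality less than $\lambda$. Call a cardinal $\kappa$ (lightface) $\Sigma^1_2$-indescribable if $\kappa$ is (strongly) inaccessible and the following reflection property holds: for every first-order formula $\Phi(X,Y,v)$ in the language of set theory with two additional unary predicates $X$, $Y$, and every $p\in V_\kappa$, if $$V_\kappa\models \exists X\,\forall Y\;\Phi(X,Y,p)$$ (where $X$ and $Y$ range over all subsets of the structure), then there is an ordinal $\xi<\kappa$ with $p\in V_\xi$ and $$V_\xi\models\exists X\,\forall Y\;\Phi(X,Y,p).$$ Write $H_\kappa\prec_{\Sigma_2}H_{\kappa^+}$ if $\Sigma_2$ formulas of the language of set theory (a block of existential quantifiers, then a block of universal quantifiers, then a formula all of whose quantifiers are bounded) with parameters in $H_\kappa$ hold in $H_\kappa$ if and only if they hold in $H_{\kappa^+}$. Then for every cardinal $\kappa$: $\kappa$ is lightface $\Sigma^1_2$-indescribable if and only if $\kappa$ is inaccessible and $H_\kappa\prec_{\Sigma_2}H_{\kappa^+}$. -/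

import Mathlib

open FirstOrder FirstOrder.Language
open scoped ZFSet

universe u

namespace LightfaceIndescribable

/-! ### The language of set theory and the Lévy classes -/

/-- Relation symbols of the language of set theory: one binary symbol. -/
inductive SetRel : ℕ → Type
  | mem : SetRel 2

/-- The first-order language of set theory (equality is a logical symbol). -/
abbrev setLang : FirstOrder.Language.{0, 0} := ⟨fun _ => Empty, SetRel⟩

/-- A set or class `M` of sets as an `∈`-structure. -/
instance setStructure (M : Set ZFSet.{u}) : setLang.Structure M where
  funMap := fun f => nomatch f
  RelMap := fun r => match r with
    | SetRel.mem => fun v => (v 0).1 ∈ (v 1).1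

/-- The atomic formula `x ∈ v`, where `x` is the bound variable with the last index `n` and `v` is
one of the variables that were already available. -/
def lastMem {α : Type} {n : ℕ} (v : α ⊕ Fin n) : setLang.BoundedFormula α (n + 1) :=
  Relations.boundedFormula₂ (L := setLang) SetRel.mem (Term.var (Sum.inr (Fin.last n)))
    (Term.var (Sum.map id Fin.castSucc v))

/-- `Δ₀` formulas: all quantifiers are bounded, `∀ x ∈ v` or `∃ x ∈ v`. -/
inductive IsDelta0 {α : Type} : ∀ {n : ℕ}, setLang.BoundedFormula α n → Prop
  | falsum {n : ℕ} : IsDelta0 (⊥ : setLang.BoundedFormula α n)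
  | atomic {n : ℕ} {φ : setLang.BoundedFormula α n} (h : φ.IsAtomic) : IsDelta0 φ
  | imp {n : ℕ} {φ ψ : setLang.BoundedFormula α n} (h₁ : IsDelta0 φ) (h₂ : IsDelta0 ψ) :
      IsDelta0 (φ.imp ψ)
  | ball {n : ℕ} (v : α ⊕ Fin n) {φ : setLang.BoundedFormula α (n + 1)} (h : IsDelta0 φ) :
      IsDelta0 ((lastMem v).imp φ).all
  | bex {n : ℕ} (v : α ⊕ Fin n) {φ : setLang.BoundedFormula α (n + 1)} (h : IsDelta0 φ) :
      IsDelta0 (lastMem v ⊓ φ).ex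

/-- `Π₁` formulas: a (possibly empty) block of universal quantifiers before a `Δ₀` formula. -/
inductive IsPi1 {α : Type} : ∀ {n : ℕ}, setLang.BoundedFormula α n → Prop
  | of_delta0 {n : ℕ} {φ : setLang.BoundedFormula α n} (h : IsDelta0 φ) : IsPi1 φ
  | all {n : ℕ} {φ : setLang.BoundedFormula α (n + 1)} (h : IsPi1 φ) : IsPi1 φ.all

/-- `Σ₂` formulas: a (possibly empty) block of existential quantifiers before a `Π₁` formula. -/
inductive IsSigma2 {α : Type} : ∀ {n : ℕ}, setLang.BoundedFormula α n → Prop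
  | of_pi1 {n : ℕ} {φ : setLang.BoundedFormula α n} (h : IsPi1 φ) : IsSigma2 φ
  | ex {n : ℕ} {φ : setLang.BoundedFormula α (n + 1)} (h : IsSigma2 φ) : IsSigma2 φ.ex

/-- `M ≺_{Σ₂} N`: `M` is a substructure of `N`, and `Σ₂` formulas with parameters from `M` have the
same truth value in `M` and in `N`. -/
def Sigma2Elementary (M N : Set ZFSet.{u}) : Prop :=
  ∃ h : M ⊆ N, ∀ (n : ℕ) (φ : setLang.Formula (Fin n)), IsSigma2 φ → ∀ a : Fin n → M,
    φ.Realize a ↔ φ.Realize (fun i => Set.inclusion h (a i))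

/-! ### The sets `H_κ` -/

/-- The transitive closure of `x`: the sets that lie in every transitive set including `x`.
(Separation from `V_ (rank x)`, which is such a set, only serves to make it a set.) -/
noncomputable def trcl (x : ZFSet.{u}) : ZFSet.{u} :=
  ZFSet.sep (fun y => ∀ t : ZFSet.{u}, t.IsTransitive → x ⊆ t → y ∈ t) (V_ (ZFSet.rank x))

theorem mem_trcl {x y : ZFSet.{u}} :
    y ∈ trcl x ↔ ∀ t : ZFSet.{u}, t.IsTransitive → x ⊆ t → y ∈ t := by
  rw [trcl, ZFSet.mem_sep]
  exact ⟨fun h => h.2, fun h =>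
    ⟨h _ (ZFSet.isTransitive_vonNeumann _) (ZFSet.subset_vonNeumann_self x), h⟩⟩

theorem subset_trcl (x : ZFSet.{u}) : x ⊆ trcl x :=
  fun _ hy => mem_trcl.2 fun _ _ hx => hx hy

theorem isTransitive_trcl (x : ZFSet.{u}) : (trcl x).IsTransitive :=
  fun _ hy _ hz => mem_trcl.2 fun t ht hx => ht _ (mem_trcl.1 hy t ht hx) hz

theorem trcl_subset {x t : ZFSet.{u}} (ht : t.IsTransitive) (hx : x ⊆ t) : trcl x ⊆ t :=
  fun _ hy => mem_trcl.1 hy t ht hx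

/-- `H_κ`, the sets whose transitive closure has cardinality less than `κ`. -/
def hered (κ : Cardinal.{u}) : Set ZFSet.{u} := {x | (trcl x).card < κ}

/-! ### `Σ¹₂` statements and reflection -/

/-- Relation symbols of the language of set theory with two additional unary predicates. -/
inductive SetPredRel : ℕ → Type
  | mem : SetPredRel 2
  | predX : SetPredRel 1
  | predY : SetPredRel 1

/-- The first-order language of set theory with two additional unary predicates. -/
abbrev setPredLang : FirstOrder.Language.{0, 0} := ⟨fun _ => Empty, SetPredRel⟩

/-- The structure `⟨M, ∈, X, Y⟩`. -/
@[reducible] def predStructure (M : Set ZFSet.{u}) (X Y : Set M) : setPredLang.Structure M where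
  funMap := fun f => nomatch f
  RelMap := fun r => match r with
    | SetPredRel.mem => fun v => (v 0).1 ∈ (v 1).1
    | SetPredRel.predX => fun v => v 0 ∈ X
    | SetPredRel.predY => fun v => v 0 ∈ Y

/-- `M ⊨ ∃ X ∀ Y Φ(X, Y, p)`, where the first-order formula `Φ` has one free first-order variable,
which is assigned `p`, and `X`, `Y` range over all subsets of `M`. -/
def SatSigma12 (M : Set ZFSet.{u}) (Φ : setPredLang.Formula (Fin 1)) (p : M) : Prop :=
  ∃ X : Set M, ∀ Y : Set M,
    letI := predStructure M X Y
    Φ.Realize (fun _ => p)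

/-- The `Σ¹₂` reflection property of a cardinal `κ`. -/
def Sigma12Reflection (κ : Cardinal.{u}) : Prop :=
  ∀ (Φ : setPredLang.Formula (Fin 1)) (p : ZFSet.{u}) (hp : p ∈ V_ κ.ord),
    SatSigma12 (V_ κ.ord : ZFSet.{u}) Φ ⟨p, hp⟩ →
      ∃ ξ < κ.ord, ∃ hξ : p ∈ V_ ξ, SatSigma12 (V_ ξ : ZFSet.{u}) Φ ⟨p, hξ⟩

/-- `κ` is (lightface) `Σ¹₂`-indescribable. -/
def IsSigma12Indescribable (κ : Cardinal.{u}) : Prop :=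
  κ.IsInaccessible ∧ Sigma12Reflection κ

end LightfaceIndescribable

namespace LightfaceIndescribable

open Cardinal

/-! For inaccessible `κ`, `H_κ = V_κ`, and every subset of `V_κ` is an element of `H_{κ⁺}`. So a
`Σ¹₂` statement about `V_κ` becomes a `Σ₂` statement over `H_{κ⁺}`: some level `M` containing `p`
and some `X` satisfy `Φ` against all `Y`. Being a level is `Π₁` once the set of earlier levels is
supplied (`LevelAt`). Elementarity moves this statement to `H_κ`. Since `H_κ` is closed under
subsets, the `M` found there is a true `V_ξ` and `Y` runs through all its subsets.

Conversely, let `π` be `Π₁`. If `π(a, xs)` holds in `H_κ`, Löwenheim–Skolem and collapse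
(`exists_transitive_reflecting`) give a transitive `T ⊆ H_κ` that agrees with `H_{κ⁺}` about `a,
xs`. Then `π` passes down to `T` and thus holds in `H_{κ⁺}`; this needs no reflection.

If `π(a, xs)` holds in `H_{κ⁺}`, reflect the statement with matrix `ReflectMatrix`: some `X` codes a
well-founded extension of the universe, and every `Y` coding a well-founded extension of that
structure satisfies `π` of `a` and of some `xs` from the structure of `X`. It is true at `V_κ`,
because all such structures collapse to transitive subsets of `H_{κ⁺}`. At `V_ξ`, `X` collapses to a
transitive subset of `H_κ`. A transitive `T` above it, of size at most `|V_ξ|` and agreeing with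
`H_κ`, is coded by some `Y`, so `π` holds in `T` and then in `H_κ`.

Well-foundedness of `X` can use the quantifier over `Y`, but that of `Y` is a hypothesis under this
quantifier and must be first order. `InnerWellFounded` is such a substitute: over `V_κ` it implies
true well-foundedness, while over `V_ξ` only the trivial converse is needed. -/

/-! ### A satisfaction predicate over arbitrary binary relations -/

/-- The variable that a term of the language of set theory consists of. -/
def termVar {γ : Type} : setLang.Term γ → γ
  | .var x => x
  | .func f _ => nomatch f

theorem realize_eq_termVar {γ : Type} {N : Type*} [setLang.Structure N] (t : setLang.Term γ)
    (v : γ → N) : t.realize v = v (termVar t) := by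
  cases t with
  | var x => rfl
  | func f _ => exact nomatch f

/-- Satisfaction in the domain `D`, where `E` interprets membership and `Q` interprets equality. -/
def Sat {β : Type*} {α : Type} (E Q : β → β → Prop) (D : Set β) :
    ∀ {n : ℕ}, setLang.BoundedFormula α n → (α → β) → (Fin n → β) → Prop
  | _, .falsum, _, _ => False
  | _, .equal t s, v, xs => Q (Sum.elim v xs (termVar t)) (Sum.elim v xs (termVar s))
  | _, .rel R ts, v, xs => match R, ts with
    | SetRel.mem, ts => E (Sum.elim v xs (termVar (ts 0))) (Sum.elim v xs (termVar (ts 1)))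
  | _, .imp φ ψ, v, xs => Sat E Q D φ v xs → Sat E Q D ψ v xs
  | _, .all φ, v, xs => ∀ x ∈ D, Sat E Q D φ v (Fin.snoc xs x)

/-- `M ⊨ φ` for a set or class `M` of sets. -/
abbrev Holds {α : Type} (M : Set ZFSet.{u}) {n : ℕ} (φ : setLang.BoundedFormula α n)
    (v : α → ZFSet.{u}) (xs : Fin n → ZFSet.{u}) : Prop :=
  Sat (fun x y => x ∈ y) (fun x y => x = y) M φ v xs

section Sat

variable {β γ : Type*} {α : Type} {E Q : β → β → Prop} {D : Set β} {n : ℕ}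

theorem sat_imp {φ ψ : setLang.BoundedFormula α n} {v : α → β} {xs : Fin n → β} :
    Sat E Q D (φ.imp ψ) v xs ↔ (Sat E Q D φ v xs → Sat E Q D ψ v xs) := Iff.rfl

theorem sat_all {φ : setLang.BoundedFormula α (n + 1)} {v : α → β} {xs : Fin n → β} :
    Sat E Q D φ.all v xs ↔ ∀ x ∈ D, Sat E Q D φ v (Fin.snoc xs x) := Iff.rfl

theorem sat_inf {φ ψ : setLang.BoundedFormula α n} {v : α → β} {xs : Fin n → β} :
    Sat E Q D (φ ⊓ ψ) v xs ↔ Sat E Q D φ v xs ∧ Sat E Q D ψ v xs := by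
  change ((Sat E Q D φ v xs → (Sat E Q D ψ v xs → False)) → False) ↔ _
  tauto

theorem sat_ex {φ : setLang.BoundedFormula α (n + 1)} {v : α → β} {xs : Fin n → β} :
    Sat E Q D φ.ex v xs ↔ ∃ x ∈ D, Sat E Q D φ v (Fin.snoc xs x) := by
  change ((∀ x ∈ D, Sat E Q D φ v (Fin.snoc xs x) → False) → False) ↔ _
  simp

theorem sat_lastMem {w : α ⊕ Fin n} {v : α → β} {xs : Fin n → β} {x : β} :
    Sat E Q D (lastMem w) v (Fin.snoc xs x) ↔ E x (Sum.elim v xs w) := by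
  change E (Sum.elim v (Fin.snoc xs x : Fin (n + 1) → β) (Sum.inr (Fin.last n)))
    (Sum.elim v (Fin.snoc xs x : Fin (n + 1) → β) (Sum.map id Fin.castSucc w)) ↔ _
  cases w <;> simp

/-- The map `f` need not be injective: equality is only an interpreted relation here, so a structure
with many codes for one set can be compared with its collapse. -/
theorem sat_transfer {E' Q' : γ → γ → Prop} {D' : Set γ} {f : β → γ} (hD : f '' D = D')
    (hE : ∀ x ∈ D, ∀ y ∈ D, E x y ↔ E' (f x) (f y))
    (hQ : ∀ x ∈ D, ∀ y ∈ D, Q x y ↔ Q' (f x) (f y)) (φ : setLang.BoundedFormula α n)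
    {v : α → β} {xs : Fin n → β} (hv : ∀ i, v i ∈ D) (hxs : ∀ i, xs i ∈ D) :
    Sat E Q D φ v xs ↔ Sat E' Q' D' φ (fun i => f (v i)) (fun i => f (xs i)) := by
  have key : ∀ {m : ℕ} (ys : Fin m → β) (w : α ⊕ Fin m), (∀ i, ys i ∈ D) →
      Sum.elim v ys w ∈ D ∧ Sum.elim (fun i => f (v i)) (fun i => f (ys i)) w =
        f (Sum.elim v ys w) := by
    rintro m ys (w | w) h
    · exact ⟨hv w, rfl⟩
    · exact ⟨h w, rfl⟩
  induction φ with
  | falsum => exact Iff.rfl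
  | equal t s =>
    change Q _ _ ↔ Q' _ _
    rw [(key xs _ hxs).2, (key xs _ hxs).2]
    exact hQ _ (key xs _ hxs).1 _ (key xs _ hxs).1
  | rel R ts =>
    cases R
    change E _ _ ↔ E' _ _
    rw [(key xs _ hxs).2, (key xs _ hxs).2]
    exact hE _ (key xs _ hxs).1 _ (key xs _ hxs).1
  | imp φ ψ ih₁ ih₂ => exact imp_congr (ih₁ hxs) (ih₂ hxs)
  | all φ ih =>
    have h : ∀ x ∈ D, (Sat E Q D φ v (Fin.snoc xs x) ↔ Sat E' Q' D' φ (fun i => f (v i))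
        (Fin.snoc (fun i => f (xs i)) (f x))) := by
      intro x hx
      have hs : ∀ i, (Fin.snoc xs x : Fin _ → β) i ∈ D := by
        intro i
        refine Fin.lastCases ?_ (fun i => ?_) i <;> simp [hx, hxs]
      refine (ih hs).trans ?_
      have : (fun i => f ((Fin.snoc xs x : Fin _ → β) i)) =
          (Fin.snoc (fun i => f (xs i)) (f x) : Fin _ → γ) := by
        funext i
        refine Fin.lastCases ?_ (fun i => ?_) i <;> simp
      rw [this]
    rw [sat_all, sat_all, ← hD, Set.forall_mem_image]
    exact forall₂_congr fun x hx => by rw [h x hx, hD]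

end Sat

theorem realize_iff_sat {α : Type} {N : Type*} [setLang.Structure N] {E : N → N → Prop}
    (hE : ∀ w : Fin 2 → N, Structure.RelMap (L := setLang) SetRel.mem w ↔ E (w 0) (w 1)) {n : ℕ}
    (φ : setLang.BoundedFormula α n) (v : α → N) (xs : Fin n → N) :
    φ.Realize v xs ↔ Sat E (fun x y => x = y) Set.univ φ v xs := by
  induction φ with
  | falsum => exact Iff.rfl
  | equal t s =>
    change t.realize _ = s.realize _ ↔ _
    rw [realize_eq_termVar, realize_eq_termVar]
    exact Iff.rfl
  | rel R ts =>
    cases R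
    refine (hE _).trans ?_
    rw [realize_eq_termVar, realize_eq_termVar]
    exact Iff.rfl
  | imp φ ψ ih₁ ih₂ => rw [BoundedFormula.realize_imp, sat_imp, ih₁, ih₂]
  | all φ ih =>
    rw [BoundedFormula.realize_all, sat_all]
    simp only [ih, Set.mem_univ, true_imp_iff]

theorem realize_iff_holds {α : Type} (M : Set ZFSet.{u}) {n : ℕ}
    (φ : setLang.BoundedFormula α n) (v : α → M) (xs : Fin n → M) :
    φ.Realize v xs ↔ Holds M φ (fun i => (v i).1) (fun i => (xs i).1) := by
  rw [realize_iff_sat (E := fun x y : M => x.1 ∈ y.1) fun _ => Iff.rfl]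
  exact sat_transfer (E' := fun x y => x ∈ y) (Q' := fun x y => x = y) (D' := M)
    (f := Subtype.val) (by simp) (fun _ _ _ _ => Iff.rfl) (fun _ _ _ _ => Subtype.ext_iff) φ
    (fun _ => trivial) (fun _ => trivial)

/-! ### Transitive classes and absoluteness -/

/-- Transitivity of a class of sets. -/
def TransClass (M : Set ZFSet.{u}) : Prop := ∀ x ∈ M, ∀ y ∈ x, y ∈ M

theorem transClass_coe {t : ZFSet.{u}} (ht : t.IsTransitive) : TransClass (t : Set ZFSet.{u}) :=
  fun _ hx _ hy => ht _ hx hy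

theorem snoc_mem {β : Type*} {D : Set β} {n : ℕ} {xs : Fin n → β} (hxs : ∀ i, xs i ∈ D) {x : β}
    (hx : x ∈ D) (i : Fin (n + 1)) : (Fin.snoc xs x : Fin (n + 1) → β) i ∈ D := by
  refine Fin.lastCases ?_ (fun i => ?_) i <;> simp [hx, hxs]

/-- A bounded quantifier ranges over members of an element of `M`, and these lie in `M` by
transitivity. -/
theorem IsDelta0.holds_iff {α : Type} {M N : Set ZFSet.{u}} (hM : TransClass M) (hN : M ⊆ N)
    {n : ℕ} {φ : setLang.BoundedFormula α n} (h : IsDelta0 φ) {v : α → ZFSet.{u}}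
    (hv : ∀ i, v i ∈ M) {xs : Fin n → ZFSet.{u}} (hxs : ∀ i, xs i ∈ M) :
    Holds M φ v xs ↔ Holds N φ v xs := by
  have key : ∀ {m : ℕ} (ys : Fin m → ZFSet.{u}) (w : α ⊕ Fin m), (∀ i, ys i ∈ M) →
      Sum.elim v ys w ∈ M := by
    rintro m ys (w | w) h
    · exact hv w
    · exact h w
  induction h with
  | falsum => exact Iff.rfl
  | atomic h =>
    cases h with
    | equal t s => exact Iff.rfl
    | rel R ts => cases R; exact Iff.rfl
  | imp _ _ ih₁ ih₂ => exact imp_congr (ih₁ hxs) (ih₂ hxs)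
  | ball w _ ih =>
    simp only [Holds, sat_all, sat_imp, sat_lastMem] at ih ⊢
    refine ⟨fun H x _ hx => ?_, fun H x hx hxw => ?_⟩
    · have hxM := hM _ (key xs w hxs) x hx
      exact (ih (snoc_mem hxs hxM)).1 (H x hxM hx)
    · exact (ih (snoc_mem hxs hx)).2 (H x (hN hx) hxw)
  | bex w _ ih =>
    simp only [Holds, sat_ex, sat_inf, sat_lastMem] at ih ⊢
    refine ⟨fun ⟨x, hx, hxw, H⟩ => ?_, fun ⟨x, _, hxw, H⟩ => ?_⟩
    · exact ⟨x, hN hx, hxw, (ih (snoc_mem hxs hx)).1 H⟩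
    · have hxM := hM _ (key xs w hxs) x hxw
      exact ⟨x, hxM, hxw, (ih (snoc_mem hxs hxM)).2 H⟩

theorem IsPi1.holds_of_subset {α : Type} {M N : Set ZFSet.{u}} (hM : TransClass M) (hN : M ⊆ N)
    {n : ℕ} {φ : setLang.BoundedFormula α n} (h : IsPi1 φ) {v : α → ZFSet.{u}}
    (hv : ∀ i, v i ∈ M) {xs : Fin n → ZFSet.{u}} (hxs : ∀ i, xs i ∈ M) (H : Holds N φ v xs) :
    Holds M φ v xs := by
  induction h with
  | of_delta0 h => exact (h.holds_iff hM hN hv hxs).2 H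
  | all _ ih => exact fun x hx => ih (snoc_mem hxs hx) (H x (hN hx))

/-- Closing under `exs` makes the induction immediate, since `exs` absorbs each leading existential
quantifier. For a formula without loose bound variables `exs` changes nothing. -/
theorem IsSigma2.exists_exs_eq {α : Type} {n : ℕ} {φ : setLang.BoundedFormula α n}
    (h : IsSigma2 φ) : ∃ (k : ℕ) (π : setLang.BoundedFormula α k), IsPi1 π ∧ φ.exs = π.exs := by
  induction h with
  | @of_pi1 n φ h => exact ⟨n, φ, h, rfl⟩
  | ex _ ih => exact ih

theorem IsSigma2.exists_pi1 {α : Type} {φ : setLang.Formula α} (h : IsSigma2 φ) :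
    ∃ (k : ℕ) (π : setLang.BoundedFormula α k), IsPi1 π ∧ ∀ (M : Set ZFSet.{u}) (v : α → M),
      φ.Realize v ↔ ∃ xs : Fin k → M, Holds M π (fun i => (v i).1) (fun i => (xs i).1) := by
  obtain ⟨k, π, hπ, he⟩ := h.exists_exs_eq
  refine ⟨k, π, hπ, fun M v => ?_⟩
  have h₀ : φ = π.exs := he
  simp only [h₀, BoundedFormula.realize_exs, realize_iff_holds]

/-! ### Cardinalities of sets and the classes `H_κ` -/

theorem hered_mono {κ μ : Cardinal.{u}} (h : κ ≤ μ) : hered κ ⊆ hered μ :=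
  fun _ hx => lt_of_lt_of_le hx h

theorem trcl_mono {x y : ZFSet.{u}} (h : x ⊆ y) : trcl x ⊆ trcl y :=
  trcl_subset (isTransitive_trcl y) fun _ hz => subset_trcl y (h hz)

theorem mem_hered_of_subset {κ : Cardinal.{u}} {x y : ZFSet.{u}} (h : x ⊆ y) (hy : y ∈ hered κ) :
    x ∈ hered κ :=
  (ZFSet.card_mono (trcl_mono h)).trans_lt hy

theorem transClass_hered (κ : Cardinal.{u}) : TransClass (hered κ) := fun x hx y hy =>
  (ZFSet.card_mono (trcl_subset (isTransitive_trcl x)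
    ((isTransitive_trcl x) y (subset_trcl x hy)))).trans_lt hx

theorem mem_hered_of_isTransitive {κ : Cardinal.{u}} {t : ZFSet.{u}} (ht : t.IsTransitive)
    (h : t.card < κ) : t ∈ hered κ :=
  (ZFSet.card_mono (trcl_subset ht fun _ hx => hx)).trans_lt h

theorem card_vonNeumann_lt {κ : Cardinal.{u}} (hκ : κ.IsInaccessible) {ξ : Ordinal.{u}}
    (hξ : ξ < κ.ord) : (V_ ξ).card < κ := by
  rw [ZFSet.card_vonNeumann]
  exact (preBeth_strictMono hξ).trans_eq hκ.preBeth_ord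

theorem card_vonNeumann_ord {κ : Cardinal.{u}} (hκ : κ.IsInaccessible) :
    (V_ κ.ord).card = κ := by
  rw [ZFSet.card_vonNeumann, hκ.preBeth_ord]

/-- This is regularity: fewer than `κ` ordinals below `κ` have their supremum below `κ`. -/
theorem rank_lt_of_card_lt {κ : Cardinal.{u}} (hκ : κ.IsInaccessible) {x : ZFSet.{u}}
    (hc : x.card < κ) (h : ∀ y ∈ x, y.rank < κ.ord) : x.rank < κ.ord := by
  have hlim := isSuccLimit_ord hκ.aleph0_lt.le
  have hlt : (⨆ y : Shrink.{u} x, ((equivShrink x).symm y).1.rank + 1) < κ.ord := by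
    refine Ordinal.iSup_lt_of_lt_cof ?_ fun y => ?_
    · exact hc.trans_le hκ.le_cof_ord
    · exact hlim.add_one_lt (h _ ((equivShrink x).symm y).2)
  refine lt_of_le_of_lt (ZFSet.rank_le_iff.2 fun y hy => ?_) hlt
  have := Ordinal.le_iSup (fun y : Shrink.{u} x => ((equivShrink x).symm y).1.rank + 1)
    (equivShrink x ⟨y, hy⟩)
  simp only [Equiv.symm_apply_apply] at this
  exact lt_of_lt_of_le (Order.lt_add_one_iff.2 le_rfl) this

/-- Regularity gives the inclusion from left to right, by `∈`-induction. The strong limit property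
gives the other, as `V_ (rank x)` is a transitive set of size below `κ` including `x`. -/
theorem hered_eq_vonNeumann {κ : Cardinal.{u}} (hκ : κ.IsInaccessible) :
    hered κ = (V_ κ.ord : Set ZFSet.{u}) := by
  ext x
  simp only [SetLike.mem_coe, ZFSet.mem_vonNeumann]
  constructor
  · intro hx
    induction x using ZFSet.inductionOn with
    | _ x ih =>
      exact rank_lt_of_card_lt hκ ((ZFSet.card_mono (subset_trcl x)).trans_lt hx)
        fun y hy => ih y hy (transClass_hered κ x hx y hy)
  · intro hx
    exact (ZFSet.card_mono (trcl_subset (ZFSet.isTransitive_vonNeumann _)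
      (ZFSet.subset_vonNeumann_self x))).trans_lt (card_vonNeumann_lt hκ hx)

/-- A transitive set of size less than `μ` together with finitely many elements of `H_μ` is included
in a transitive set of size less than `μ`. -/
theorem exists_isTransitive_superset {μ : Cardinal.{u}} (hμ : ℵ₀ ≤ μ) {B : ZFSet.{u}}
    (hB : B.IsTransitive) (hBc : B.card < μ) {k : ℕ} (xs : Fin k → ZFSet.{u})
    (hxs : ∀ i, xs i ∈ hered μ) :
    ∃ T : ZFSet.{u}, T.IsTransitive ∧ B ⊆ T ∧ (∀ i, xs i ∈ T) ∧ T.card < μ := by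
  induction k with
  | zero => exact ⟨B, hB, fun _ h => h, fun i => i.elim0, hBc⟩
  | succ k ih =>
    obtain ⟨T, hT, hBT, hxT, hTc⟩ := ih (fun i => xs i.castSucc) fun i => hxs _
    let x := xs (Fin.last k)
    refine ⟨T ∪ insert x (trcl x), hT.union ?_, fun y hy => ZFSet.mem_union.2 (.inl (hBT hy)),
      fun i => ?_, ?_⟩
    · intro y hy z hz
      rcases ZFSet.mem_insert_iff.1 hy with rfl | hy
      · exact ZFSet.mem_insert_iff.2 (.inr (subset_trcl _ hz))
      · exact ZFSet.mem_insert_iff.2 (.inr (isTransitive_trcl x y hy hz))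
    · refine Fin.lastCases ?_ (fun i => ?_) i
      · simp [x]
      · exact ZFSet.mem_union.2 (.inl (hxT i))
    · refine ZFSet.card_union_le.trans_lt (add_lt_of_lt hμ hTc
        (ZFSet.card_insert_le.trans_lt (add_lt_of_lt hμ (hxs _) ?_)))
      exact one_lt_aleph0.trans_le hμ

theorem card_le_of_surjective {A B : ZFSet.{u}} (f : A → ZFSet.{u})
    (h : ∀ b ∈ B, ∃ a, f a = b) : B.card ≤ A.card := by
  rw [← lift_le.{u + 1}, ← ZFSet.cardinalMk_coe_sort, ← ZFSet.cardinalMk_coe_sort]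
  choose g hg using fun b : B => h b.1 b.2
  exact mk_le_of_injective (f := g) fun b b' hb => Subtype.ext (by rw [← hg b, hb, hg b'])

theorem exists_surjective_of_card_le {A B : ZFSet.{u}} (h : B.card ≤ A.card) (hB : B.Nonempty) :
    ∃ g : A → ZFSet.{u}, (∀ a, g a ∈ B) ∧ ∀ b ∈ B, ∃ a, g a = b := by
  rw [← lift_le.{u + 1}, ← ZFSet.cardinalMk_coe_sort, ← ZFSet.cardinalMk_coe_sort] at h
  obtain ⟨e⟩ := h
  obtain ⟨b₀, hb₀⟩ := hB
  have : Nonempty B := ⟨⟨b₀, hb₀⟩⟩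
  exact ⟨fun a => (Function.invFun e a).1, fun a => (Function.invFun e a).2, fun b hb =>
    ⟨e ⟨b, hb⟩, congrArg Subtype.val (Function.leftInverse_invFun e.injective _)⟩⟩

/-! ### The Mostowski collapse -/

/-- The relation of having the same `E`-predecessors. -/
def Coext {β : Type*} (E : β → β → Prop) (u v : β) : Prop := ∀ w, E w u ↔ E w v

/-- `E` respects coextensionality in its left argument. -/
def CoextCongr {β : Type*} (E : β → β → Prop) : Prop :=
  ∀ u v, Coext E u v → ∀ w, E u w → E v w

/-- `f` sends every `v` to the set of values of `f` at the `E`-predecessors of `v`. -/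
def IsCollapse {β : Type*} (E : β → β → Prop) (f : β → ZFSet.{u}) : Prop :=
  ∀ v z, z ∈ f v ↔ ∃ u, E u v ∧ f u = z

section Collapse

variable {β : Type*} {E : β → β → Prop} {f : β → ZFSet.{u}}

theorem Coext.symm {u v : β} (h : Coext E u v) : Coext E v u := fun w => (h w).symm

theorem exists_isCollapse [Small.{u} β] (hE : WellFounded E) :
    ∃ f : β → ZFSet.{u}, IsCollapse E f := by
  refine ⟨hE.fix fun v ih => ZFSet.range fun u : {u // E u v} => ih u.1 u.2, fun v z => ?_⟩
  rw [hE.fix_eq, ZFSet.mem_range]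
  simp

theorem IsCollapse.mem_of_rel (hf : IsCollapse E f) {u v : β} (h : E u v) : f u ∈ f v :=
  (hf v _).2 ⟨u, h, rfl⟩

theorem IsCollapse.wellFounded (hf : IsCollapse E f) : WellFounded E :=
  Subrelation.wf (fun h => hf.mem_of_rel h) (InvImage.wf f ZFSet.mem_wf)

theorem IsCollapse.eq_of_coext (hf : IsCollapse E f) {u v : β} (h : Coext E u v) : f u = f v := by
  ext z
  rw [hf, hf]
  simp only [h _]

/-- If `f u = f v`, each predecessor of `u` has the same value as some predecessor of `v`. By
induction the two are coextensional, and `CoextCongr` lets one replace the other. -/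
theorem IsCollapse.coext_iff (hf : IsCollapse E f) (hE : CoextCongr E) {u v : β} :
    Coext E u v ↔ f u = f v := by
  refine ⟨hf.eq_of_coext, ?_⟩
  induction u using hf.wellFounded.induction generalizing v with
  | _ u ih =>
    intro h w
    constructor
    · intro hw
      obtain ⟨w', hw', e⟩ := (hf v _).1 (h ▸ hf.mem_of_rel hw)
      exact hE _ _ (ih w hw e.symm).symm v hw'
    · intro hw
      obtain ⟨w', hw', e⟩ := (hf u _).1 (h ▸ hf.mem_of_rel hw)
      exact hE _ _ (ih w' hw' e) u hw'

theorem IsCollapse.rel_iff (hf : IsCollapse E f) (hE : CoextCongr E) {u v : β} :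
    E u v ↔ f u ∈ f v := by
  refine ⟨hf.mem_of_rel, fun h => ?_⟩
  obtain ⟨w, hw, e⟩ := (hf v _).1 h
  exact hE _ _ ((hf.coext_iff hE).2 e) v hw

theorem IsCollapse.isTransitive_range [Small.{u} β] (hf : IsCollapse E f) :
    (ZFSet.range f).IsTransitive := by
  intro x hx y hy
  obtain ⟨v, rfl⟩ := ZFSet.mem_range.1 hx
  obtain ⟨u, _, rfl⟩ := (hf v y).1 hy
  exact ZFSet.mem_range_self u

theorem IsCollapse.sat_iff [Small.{u} β] (hf : IsCollapse E f) (hE : CoextCongr E) {α : Type}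
    {n : ℕ} (φ : setLang.BoundedFormula α n) (v : α → β) (xs : Fin n → β) :
    Sat E (Coext E) Set.univ φ v xs ↔
      Holds (ZFSet.range f : Set ZFSet.{u}) φ (fun i => f (v i)) (fun i => f (xs i)) :=
  sat_transfer (f := f) (D := Set.univ) (E' := fun x y => x ∈ y) (Q' := fun x y => x = y)
    (D' := (ZFSet.range f : Set ZFSet.{u})) (by simp [ZFSet.coe_range])
    (fun _ _ _ _ => hf.rel_iff hE) (fun _ _ _ _ => hf.coext_iff hE) φ (fun _ => trivial)
    (fun _ => trivial)

theorem IsCollapse.of_surjective {T : ZFSet.{u}} (hT : T.IsTransitive) (hfT : ∀ v, f v ∈ T)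
    (hs : ∀ t ∈ T, ∃ v, f v = t) : IsCollapse (fun u v => f u ∈ f v) f := by
  refine fun v z => ⟨fun h => ?_, fun ⟨u, h, e⟩ => e ▸ h⟩
  obtain ⟨u, rfl⟩ := hs z (hT _ (hfT v) h)
  exact ⟨u, h, rfl⟩

theorem IsCollapse.coextCongr_of_mem (hf : IsCollapse (fun u v => f u ∈ f v) f) :
    CoextCongr fun u v => f u ∈ f v := by
  intro u v h w hw
  rwa [← hf.eq_of_coext h]

end Collapse

/-! ### Reflection to small transitive sets by Löwenheim–Skolem -/

theorem card_setLang_le : setLang.card ≤ ℵ₀ := by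
  have h : ∀ n, Countable (SetRel n) := fun n =>
    have : Subsingleton (SetRel n) := ⟨fun a b => by cases a; cases b; rfl⟩
    inferInstance
  have : Countable setLang.Symbols :=
    inferInstanceAs (Countable ((Σ _ : ℕ, Empty) ⊕ (Σ n, SetRel n)))
  exact mk_le_aleph0

/-- Downward Löwenheim–Skolem over a transitive set, followed by the Mostowski collapse. -/
theorem exists_transitive_reflecting {H : Set ZFSet.{u}} (hH : TransClass H) {T₀ : ZFSet.{u}}
    (hT₀ : T₀.IsTransitive) (hT₀H : (T₀ : Set ZFSet.{u}) ⊆ H) {c : Cardinal.{u}} (hc : ℵ₀ ≤ c)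
    (hT₀c : T₀.card ≤ c) (hcH : lift.{u + 1} c ≤ #H) :
    ∃ T : ZFSet.{u}, T.IsTransitive ∧ T₀ ⊆ T ∧ T.card ≤ c ∧
      ∀ {α : Type} {n : ℕ} (φ : setLang.BoundedFormula α n) (v : α → ZFSet.{u})
        (xs : Fin n → ZFSet.{u}), (∀ i, v i ∈ T₀) → (∀ i, xs i ∈ T₀) →
        (Holds (T : Set ZFSet.{u}) φ v xs ↔ Holds H φ v xs) := by
  obtain ⟨S, hS, hSc⟩ := exists_elementarySubstructure_card_eq setLang
    {x : H | x.1 ∈ T₀} c hc (by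
      rw [lift_id'.{u, u + 1}]
      refine le_trans ?_ (lift_le.{u + 1}.2 hT₀c)
      rw [← ZFSet.cardinalMk_coe_sort]
      exact mk_le_of_injective (f := fun x : {x : H | x.1 ∈ T₀} => (⟨x.1.1, x.2⟩ : T₀))
        fun x y h => Subtype.ext (Subtype.ext (Subtype.mk.inj h))) (by
      exact (lift_le_aleph0.2 card_setLang_le).trans (aleph0_le_lift.2 hc)) (by rwa [lift_id'.{u, u + 1}])
  rw [lift_id'.{u, u + 1}] at hSc
  -- The elementary substructure lives one universe up; its cardinality `c` is what allows it to be
  -- collapsed to a set.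
  have hsmall : Small.{u} S := by
    obtain ⟨e⟩ := Cardinal.eq.1 (hSc.trans (mk_uLift c.out ▸ by rw [mk_out]) :
      #S = #(ULift.{u + 1} c.out))
    exact ⟨c.out, ⟨e.trans Equiv.ulift⟩⟩
  let E : S → S → Prop := fun x y => x.1.1 ∈ y.1.1
  obtain ⟨f, hf⟩ : ∃ f : S → ZFSet.{u}, IsCollapse E f :=
    exists_isCollapse (InvImage.wf (fun x : S => x.1.1) ZFSet.mem_wf)
  have hreal : ∀ {α : Type} {n : ℕ} (φ : setLang.BoundedFormula α n) (v : α → S) (xs : Fin n → S),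
      Sat E (fun x y => x = y) Set.univ φ v xs ↔
        Holds H φ (fun i => (v i).1.1) (fun i => (xs i).1.1) := by
    intro α n φ v xs
    rw [← realize_iff_sat (E := E) fun _ => Iff.rfl, ← S.subtype.map_boundedFormula φ v xs,
      realize_iff_holds]
    rfl
  -- Extensionality holds in the transitive class `H` and is inherited by the elementary
  -- substructure.
  have hext : ∀ x y, Coext E x y → x = y := by
    intro x y hxy
    let φ : setLang.Formula (Fin 2) :=
      BoundedFormula.all (((lastMem (.inl 0)).imp (lastMem (.inl 1))) ⊓
        ((lastMem (.inl 1)).imp (lastMem (.inl 0))))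
    have h := (hreal φ ![x, y] Fin.elim0).1 (by
      simp only [φ, sat_all, sat_inf, sat_imp, sat_lastMem]
      exact fun z _ => ⟨(hxy z).1, (hxy z).2⟩)
    simp only [φ, Holds, sat_all, sat_inf, sat_imp, sat_lastMem] at h
    refine Subtype.ext (Subtype.ext (ZFSet.ext fun z => ⟨fun hz => ?_, fun hz => ?_⟩))
    · exact (h z (hH _ x.1.2 z hz)).1 hz
    · exact (h z (hH _ y.1.2 z hz)).2 hz
  have hcong : CoextCongr E := fun x y h w hw => hext x y h ▸ hw
  -- The collapse is the identity on a transitive part of its domain.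
  have hfix : ∀ (x : ZFSet.{u}) (hx : x ∈ T₀), f ⟨⟨x, hT₀H hx⟩, hS hx⟩ = x := by
    intro x
    induction x using ZFSet.inductionOn with
    | _ x ih =>
      intro hx
      ext z
      rw [hf]
      constructor
      · rintro ⟨y, hy, rfl⟩
        have := ih y.1.1 hy (hT₀ x hx hy)
        exact this.symm ▸ hy
      · exact fun hz => ⟨⟨⟨z, _⟩, hS (hT₀ x hx hz)⟩, hz, ih z hz (hT₀ x hx hz)⟩
  refine ⟨ZFSet.range f, hf.isTransitive_range, fun x hx => ?_, ?_, ?_⟩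
  · exact ZFSet.mem_range.2 ⟨_, hfix x hx⟩
  · have := ZFSet.lift_card_range_le.{u + 1, u} (f := f)
    rwa [hSc, lift_lift, lift_le] at this
  · intro α n φ v xs hv hxs
    have hfix' : ∀ {ι : Type} (w : ι → ZFSet.{u}) (hw : ∀ i, w i ∈ T₀),
        (fun i => f ⟨⟨w i, hT₀H (hw i)⟩, hS (hw i)⟩) = w := fun w hw =>
      funext fun i => hfix _ (hw i)
    have hQ : Coext E = fun x y => x = y := by
      funext x y
      exact propext ⟨hext x y, fun h => h ▸ fun _ => Iff.rfl⟩
    have h := hf.sat_iff hcong φ (fun i => ⟨⟨v i, hT₀H (hv i)⟩, hS (hv i)⟩)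
      (fun i => ⟨⟨xs i, hT₀H (hxs i)⟩, hS (hxs i)⟩)
    rw [hfix' v hv, hfix' xs hxs, hQ, hreal] at h
    exact h.symm

/-! ### Definability by `Δ₀`, `Π₁` and `Σ₂` formulas -/

/-- The embedding of a list of variables into the list extended by one bound variable. -/
def weaken {α : Type} {n : ℕ} : α ⊕ Fin n → α ⊕ Fin (n + 1) := Sum.map id Fin.castSucc

/-- The bound variable with the last index. -/
def lastVar {α : Type} {n : ℕ} : α ⊕ Fin (n + 1) := Sum.inr (Fin.last n)

/-- Extension of a valuation to one more bound variable. -/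
def extendVal {α : Type} {β : Type*} {n : ℕ} (e : α ⊕ Fin n → β) (x : β) : α ⊕ Fin (n + 1) → β :=
  Sum.elim (fun i => e (Sum.inl i)) (Fin.snoc (fun i => e (Sum.inr i)) x)

section Definability

variable {α : Type} {β : Type*} {n : ℕ}

@[simp] theorem extendVal_weaken (e : α ⊕ Fin n → β) (x : β) (i : α ⊕ Fin n) :
    extendVal e x (weaken i) = e i := by
  cases i <;> simp [extendVal, weaken]

@[simp] theorem extendVal_lastVar (e : α ⊕ Fin n → β) (x : β) :
    extendVal e x lastVar = x := by
  simp [extendVal, lastVar]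

theorem extendVal_mem {D : Set β} {e : α ⊕ Fin n → β} (he : ∀ i, e i ∈ D) {x : β} (hx : x ∈ D)
    (i : α ⊕ Fin (n + 1)) : extendVal e x i ∈ D := by
  cases i with
  | inl i => exact he _
  | inr i => exact snoc_mem (fun i => he _) hx i

/-- The property `Q` is uniformly defined by a `Δ₀` formula. -/
def Delta0Def (Q : (α ⊕ Fin n → ZFSet.{u}) → Prop) : Prop :=
  ∃ φ : setLang.BoundedFormula α n, IsDelta0 φ ∧ ∀ e : α ⊕ Fin n → ZFSet.{u},
    Holds Set.univ φ (fun i => e (Sum.inl i)) (fun i => e (Sum.inr i)) ↔ Q e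

/-- The property `Q` is defined by a `Π₁` formula, uniformly in all transitive classes. -/
def Pi1Def (Q : Set ZFSet.{u} → (α ⊕ Fin n → ZFSet.{u}) → Prop) : Prop :=
  ∃ φ : setLang.BoundedFormula α n, IsPi1 φ ∧ ∀ H : Set ZFSet.{u}, TransClass H →
    ∀ e : α ⊕ Fin n → ZFSet.{u}, (∀ i, e i ∈ H) →
      (Holds H φ (fun i => e (Sum.inl i)) (fun i => e (Sum.inr i)) ↔ Q H e)

/-- The property `Q` is defined by a `Σ₂` formula, uniformly in all transitive classes. -/
def Sigma2Def (Q : Set ZFSet.{u} → (α ⊕ Fin n → ZFSet.{u}) → Prop) : Prop :=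
  ∃ φ : setLang.BoundedFormula α n, IsSigma2 φ ∧ ∀ H : Set ZFSet.{u}, TransClass H →
    ∀ e : α ⊕ Fin n → ZFSet.{u}, (∀ i, e i ∈ H) →
      (Holds H φ (fun i => e (Sum.inl i)) (fun i => e (Sum.inr i)) ↔ Q H e)

/-- The atomic formula `i ∈ j` for variables `i` and `j`. -/
def memFormula (i j : α ⊕ Fin n) : setLang.BoundedFormula α n :=
  Relations.boundedFormula₂ (L := setLang) SetRel.mem (Term.var i) (Term.var j)

theorem sumElim_comp (e : α ⊕ Fin n → β) (i : α ⊕ Fin n) :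
    Sum.elim (fun i => e (Sum.inl i)) (fun i => e (Sum.inr i)) i = e i := by
  cases i <;> rfl

namespace Delta0Def

theorem mem (i j : α ⊕ Fin n) : Delta0Def fun e : α ⊕ Fin n → ZFSet.{u} => e i ∈ e j := by
  refine ⟨memFormula i j, .atomic (.rel _ _), fun e => ?_⟩
  change Sum.elim _ _ i ∈ Sum.elim _ _ j ↔ _
  rw [sumElim_comp, sumElim_comp]

theorem eq (i j : α ⊕ Fin n) : Delta0Def fun e : α ⊕ Fin n → ZFSet.{u} => e i = e j := by
  refine ⟨.equal (.var i) (.var j), .atomic (.equal _ _), fun e => ?_⟩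
  change Sum.elim _ _ i = Sum.elim _ _ j ↔ _
  rw [sumElim_comp, sumElim_comp]

theorem false : Delta0Def fun _ : α ⊕ Fin n → ZFSet.{u} => False :=
  ⟨⊥, .falsum, fun _ => Iff.rfl⟩

variable {Q R : (α ⊕ Fin n → ZFSet.{u}) → Prop}

theorem congr (hQ : Delta0Def Q) (h : ∀ e, R e ↔ Q e) : Delta0Def R := by
  obtain ⟨φ, hφ, H⟩ := hQ
  exact ⟨φ, hφ, fun e => (H e).trans (h e).symm⟩

theorem imp (hQ : Delta0Def Q) (hR : Delta0Def R) : Delta0Def fun e => Q e → R e := by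
  obtain ⟨φ, hφ, H⟩ := hQ
  obtain ⟨ψ, hψ, K⟩ := hR
  exact ⟨φ.imp ψ, .imp hφ hψ, fun e => imp_congr (H e) (K e)⟩

theorem and (hQ : Delta0Def Q) (hR : Delta0Def R) : Delta0Def fun e => Q e ∧ R e :=
  ((hQ.imp (hR.imp false)).imp false).congr fun e => by tauto

theorem ball {S : (α ⊕ Fin n → ZFSet.{u}) → ZFSet.{u} → Prop} (w : α ⊕ Fin n)
    (hS : Delta0Def fun e : α ⊕ Fin (n + 1) → ZFSet.{u} =>
      S (fun i => e (weaken i)) (e lastVar)) :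
    Delta0Def fun e => ∀ x ∈ e w, S e x := by
  obtain ⟨φ, hφ, H⟩ := hS
  refine ⟨_, .ball w hφ, fun e => ?_⟩
  simp only [Holds, sat_all, sat_imp, sat_lastMem, sumElim_comp, Set.mem_univ, true_imp_iff]
  refine forall₂_congr fun x _ => ?_
  refine (H (extendVal e x)).trans ?_
  simp only [extendVal_weaken, extendVal_lastVar]

theorem bex {S : (α ⊕ Fin n → ZFSet.{u}) → ZFSet.{u} → Prop} (w : α ⊕ Fin n)
    (hS : Delta0Def fun e : α ⊕ Fin (n + 1) → ZFSet.{u} =>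
      S (fun i => e (weaken i)) (e lastVar)) :
    Delta0Def fun e => ∃ x ∈ e w, S e x := by
  refine ((ball (S := fun e x => S e x → False) w (hS.imp false)).imp false).congr fun e => ?_
  simp

theorem subset (i j : α ⊕ Fin n) : Delta0Def fun e : α ⊕ Fin n → ZFSet.{u} => e i ⊆ e j :=
  ball (S := fun e x => x ∈ e j) i (mem _ _)

theorem pi1Def (hQ : Delta0Def Q) : Pi1Def fun _ e => Q e := by
  obtain ⟨φ, hφ, H⟩ := hQ
  exact ⟨φ, .of_delta0 hφ, fun M hM e he => (hφ.holds_iff hM (Set.subset_univ _) (fun _ => he _)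
    (fun _ => he _)).trans (H e)⟩

end Delta0Def

theorem Pi1Def.all {S : Set ZFSet.{u} → (α ⊕ Fin n → ZFSet.{u}) → ZFSet.{u} → Prop}
    (hS : Pi1Def fun H (e : α ⊕ Fin (n + 1) → ZFSet.{u}) =>
      S H (fun i => e (weaken i)) (e lastVar)) :
    Pi1Def fun H e => ∀ x ∈ H, S H e x := by
  obtain ⟨φ, hφ, K⟩ := hS
  refine ⟨_, .all hφ, fun H hH e he => ?_⟩
  simp only [Holds, sat_all]
  refine forall₂_congr fun x hx => ?_
  refine (K H hH (extendVal e x) (extendVal_mem he hx)).trans ?_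
  simp only [extendVal_weaken, extendVal_lastVar]

theorem Pi1Def.sigma2Def {Q : Set ZFSet.{u} → (α ⊕ Fin n → ZFSet.{u}) → Prop} (hQ : Pi1Def Q) :
    Sigma2Def Q := by
  obtain ⟨φ, hφ, H⟩ := hQ
  exact ⟨φ, .of_pi1 hφ, H⟩

theorem Sigma2Def.ex {S : Set ZFSet.{u} → (α ⊕ Fin n → ZFSet.{u}) → ZFSet.{u} → Prop}
    (hS : Sigma2Def fun H (e : α ⊕ Fin (n + 1) → ZFSet.{u}) =>
      S H (fun i => e (weaken i)) (e lastVar)) :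
    Sigma2Def fun H e => ∃ x ∈ H, S H e x := by
  obtain ⟨φ, hφ, K⟩ := hS
  refine ⟨_, .ex hφ, fun H hH e he => ?_⟩
  simp only [Holds, sat_ex]
  refine exists_congr fun x => and_congr_right fun hx => ?_
  refine (K H hH (extendVal e x) (extendVal_mem he hx)).trans ?_
  simp only [extendVal_weaken, extendVal_lastVar]

end Definability

/-! ### Satisfaction with two predicates, relativized to a set -/

/-- The variable that a term of the language with two predicates consists of. -/
def predTermVar {γ : Type} : setPredLang.Term γ → γ
  | .var x => x
  | .func f _ => nomatch f

/-- `⟨M, ∈, X, Y⟩ ⊨ Φ` for sets `M`, `X`, `Y`. -/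
def PredHolds {α : Type} (M X Y : ZFSet.{u}) :
    ∀ {n : ℕ}, setPredLang.BoundedFormula α n → (α ⊕ Fin n → ZFSet.{u}) → Prop
  | _, .falsum, _ => False
  | _, .equal t s, e => e (predTermVar t) = e (predTermVar s)
  | _, .rel R ts, e => match R, ts with
    | SetPredRel.mem, ts => e (predTermVar (ts 0)) ∈ e (predTermVar (ts 1))
    | SetPredRel.predX, ts => e (predTermVar (ts 0)) ∈ X
    | SetPredRel.predY, ts => e (predTermVar (ts 0)) ∈ Y
  | _, .imp φ ψ, e => PredHolds M X Y φ e → PredHolds M X Y ψ e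
  | _, .all φ, e => ∀ x ∈ M, PredHolds M X Y φ (extendVal e x)

/-- With `M`, `X`, `Y` turned into set variables, all quantifiers of `Φ` become bounded by `M`,
whatever the complexity of `Φ`. The map `g` tells which variables interpret those of `Φ`. -/
theorem delta0Def_predHolds {α γ : Type} {m : ℕ} (Φ : setPredLang.BoundedFormula γ m) {n : ℕ}
    (M X Y : α ⊕ Fin n) (g : γ ⊕ Fin m → α ⊕ Fin n) :
    Delta0Def fun e : α ⊕ Fin n → ZFSet.{u} =>
      PredHolds (e M) (e X) (e Y) Φ fun i => e (g i) := by
  induction Φ generalizing n with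
  | falsum => exact .false
  | equal t s => exact .eq _ _
  | rel R ts =>
    cases R
    · exact .mem _ _
    · exact .mem _ _
    · exact .mem _ _
  | imp φ ψ ih₁ ih₂ => exact (ih₁ M X Y g).imp (ih₂ M X Y g)
  | all φ ih =>
    refine Delta0Def.ball
      (S := fun e x => PredHolds (e M) (e X) (e Y) φ (extendVal (fun i => e (g i)) x)) M
      ((ih (weaken M) (weaken X) (weaken Y)
        (extendVal (fun i => weaken (g i)) lastVar)).congr fun e => ?_)
    have : extendVal (fun i => e (weaken (g i))) (e lastVar) =
        fun i => e (extendVal (fun i => weaken (g i)) lastVar i) := by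
      funext i
      rcases i with i | i
      · rfl
      · refine Fin.lastCases ?_ (fun i => ?_) i <;> simp [extendVal]
    rw [this]

theorem realize_iff_predHolds {α : Type} (M X Y : ZFSet.{u}) {n : ℕ}
    (Φ : setPredLang.BoundedFormula α n) (v : α → (M : Set ZFSet.{u}))
    (xs : Fin n → (M : Set ZFSet.{u})) :
    @BoundedFormula.Realize setPredLang _ (predStructure (M : Set ZFSet.{u}) {x | x.1 ∈ X}
      {y | y.1 ∈ Y}) _ _ Φ v xs ↔ PredHolds M X Y Φ fun i => (Sum.elim v xs i).1 := by
  let := predStructure (M : Set ZFSet.{u}) {x | x.1 ∈ X} {y | y.1 ∈ Y}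
  have ht : ∀ {γ : Type} (t : setPredLang.Term γ) (w : γ → (M : Set ZFSet.{u})),
      t.realize w = w (predTermVar t) := by
    intro γ t w
    cases t with
    | var x => rfl
    | func f _ => exact nomatch f
  change Φ.Realize v xs ↔ _
  induction Φ with
  | falsum => exact Iff.rfl
  | equal t s =>
    change t.realize _ = s.realize _ ↔ _
    rw [ht, ht]
    exact Subtype.ext_iff
  | rel R ts =>
    cases R
    · change ((ts 0).realize (Sum.elim v xs)).1 ∈ ((ts 1).realize (Sum.elim v xs)).1 ↔ _
      rw [ht, ht]
      exact Iff.rfl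
    · change ((ts 0).realize (Sum.elim v xs)).1 ∈ X ↔ _
      rw [ht]
      exact Iff.rfl
    · change ((ts 0).realize (Sum.elim v xs)).1 ∈ Y ↔ _
      rw [ht]
      exact Iff.rfl
  | imp φ ψ ih₁ ih₂ => exact imp_congr (ih₁ xs) (ih₂ xs)
  | all φ ih =>
    rw [BoundedFormula.realize_all]
    change _ ↔ ∀ x ∈ M, _
    have : ∀ x : (M : Set ZFSet.{u}), (fun i => (Sum.elim v (Fin.snoc xs x) i).1) =
        extendVal (fun i => (Sum.elim v xs i).1) x.1 := by
      intro x
      funext i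
      rcases i with i | i
      · rfl
      · refine Fin.lastCases ?_ (fun i => ?_) i <;> simp [extendVal]
    simp only [ih, this]
    exact Subtype.forall

theorem formula_realize_iff_predHolds (M X Y : ZFSet.{u}) (Φ : setPredLang.Formula (Fin 1))
    (p : (M : Set ZFSet.{u})) :
    @Formula.Realize setPredLang _ (predStructure (M : Set ZFSet.{u})
      {x | x.1 ∈ X} {y | y.1 ∈ Y}) _ Φ (fun _ => p) ↔ PredHolds M X Y Φ fun _ => p.1 := by
  refine (realize_iff_predHolds M X Y Φ (fun _ => p) default).trans ?_
  have : (fun i : Fin 1 ⊕ Fin 0 => (Sum.elim (fun _ => p) default i).1) = fun _ => p.1 := by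
    funext i
    rcases i with i | i
    · rfl
    · exact i.elim0
  rw [this]

theorem exists_eq_setOf_mem (M : ZFSet.{u}) (X : Set (M : Set ZFSet.{u})) :
    ∃ X' ⊆ M, {x : (M : Set ZFSet.{u}) | x.1 ∈ X'} = X := by
  refine ⟨ZFSet.sep (fun x => ∃ h : x ∈ M, (⟨x, h⟩ : (M : Set ZFSet.{u})) ∈ X) M,
    fun x hx => (ZFSet.mem_sep.1 hx).1, ?_⟩
  ext x
  change x.1 ∈ ZFSet.sep _ M ↔ _
  rw [ZFSet.mem_sep]
  exact ⟨fun h => h.2.2, fun h => ⟨x.2, x.2, h⟩⟩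

theorem SatSigma12.exists_predHolds {M : ZFSet.{u}} {Φ : setPredLang.Formula (Fin 1)}
    {p : (M : Set ZFSet.{u})} (h : SatSigma12 (M : Set ZFSet.{u}) Φ p) :
    ∃ X ⊆ M, ∀ Y, PredHolds M X Y Φ fun _ => p.1 := by
  obtain ⟨X, hX⟩ := h
  obtain ⟨X', hX', rfl⟩ := exists_eq_setOf_mem M X
  exact ⟨X', hX', fun Y => (formula_realize_iff_predHolds M X' Y Φ p).1 (hX {y | y.1 ∈ Y})⟩

theorem satSigma12_of_predHolds {M X : ZFSet.{u}} {Φ : setPredLang.Formula (Fin 1)}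
    {p : (M : Set ZFSet.{u})} (h : ∀ Y ⊆ M, PredHolds M X Y Φ fun _ => p.1) :
    SatSigma12 (M : Set ZFSet.{u}) Φ p := by
  refine ⟨{x | x.1 ∈ X}, fun Y => ?_⟩
  obtain ⟨Y', hY', rfl⟩ := exists_eq_setOf_mem M Y
  exact (formula_realize_iff_predHolds M X Y' Φ p).2 (h Y' hY')

/-! ### Levels of the cumulative hierarchy -/

/-- The instance at `x` of the statement that `M` is the level whose set of earlier levels is
`h`. -/
def LevelAt (M h x : ZFSet.{u}) : Prop :=
  (∀ y ∈ h, x ⊆ y → x ∈ M) ∧ (∀ z ∈ M, ∃ y ∈ h, z ⊆ y) ∧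
    (∀ v ∈ h, ∀ w ∈ h, w ∈ v → x ⊆ w → x ∈ v) ∧ ∀ v ∈ h, ∀ z ∈ v, ∃ w ∈ h, w ∈ v ∧ z ⊆ w

theorem delta0Def_levelAt {α : Type} {n : ℕ} (M h x : α ⊕ Fin n) :
    Delta0Def fun e : α ⊕ Fin n → ZFSet.{u} => LevelAt (e M) (e h) (e x) := by
  refine .and ?_ (.and ?_ (.and ?_ ?_))
  · exact .ball (S := fun e y => e x ⊆ y → e x ∈ e M) h (.imp (.subset _ _) (.mem _ _))
  · exact .ball (S := fun e z => ∃ y ∈ e h, z ⊆ y) M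
      (.bex (S := fun e y => e lastVar ⊆ y) _ (.subset _ _))
  · exact .ball (S := fun e v => ∀ w ∈ e h, w ∈ v → e x ⊆ w → e x ∈ v) h
      (.ball (S := fun e w => w ∈ e lastVar → e (weaken x) ⊆ w → e (weaken x) ∈ e lastVar) _
        (.imp (.mem _ _) (.imp (.subset _ _) (.mem _ _))))
  · exact .ball (S := fun e v => ∀ z ∈ v, ∃ w ∈ e h, w ∈ v ∧ z ⊆ w) h
      (.ball (S := fun e z => ∃ w ∈ e (weaken h), w ∈ e lastVar ∧ z ⊆ w) _
        (.bex (S := fun e w => w ∈ e (weaken lastVar) ∧ e lastVar ⊆ w) _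
          (.and (.mem _ _) (.subset _ _))))

theorem levelAt_vonNeumann (o : Ordinal.{u}) (x : ZFSet.{u}) :
    LevelAt (V_ o) (ZFSet.range fun a : Set.Iio o => V_ a.1) x := by
  have hmem : ∀ y, y ∈ (ZFSet.range fun a : Set.Iio o => V_ a.1) ↔ ∃ a < o, V_ a = y := by simp
  simp only [LevelAt, hmem]
  refine ⟨?_, fun z hz => ?_, ?_, ?_⟩
  · rintro _ ⟨a, ha, rfl⟩ hx
    exact ZFSet.mem_vonNeumann'.2 ⟨a, ha, hx⟩
  · obtain ⟨a, ha, h⟩ := ZFSet.mem_vonNeumann'.1 hz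
    exact ⟨_, ⟨a, ha, rfl⟩, h⟩
  · rintro _ ⟨a, ha, rfl⟩ _ ⟨b, hb, rfl⟩ hba hx
    exact ZFSet.mem_vonNeumann'.2 ⟨b, ZFSet.vonNeumann_mem_vonNeumann_iff.1 hba, hx⟩
  · rintro _ ⟨a, ha, rfl⟩ z hz
    obtain ⟨b, hb, h⟩ := ZFSet.mem_vonNeumann'.1 hz
    exact ⟨_, ⟨b, hb.trans ha, rfl⟩, ZFSet.vonNeumann_mem_of_lt hb, h⟩

/-- The clauses of `LevelAt` say that `M` is the union of the power sets of the members of `h`, and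
that each `v ∈ h` is the union of the power sets of the members of `h` in `v`. Closure of `H` under
subsets makes these true power sets, and `∈`-induction identifies every member of `h`, then `M`,
with a level. -/
theorem eq_vonNeumann_of_levelAt {H : Set ZFSet.{u}} (hH : TransClass H)
    (hsub : ∀ x y, x ⊆ y → y ∈ H → x ∈ H) {M h : ZFSet.{u}} (hh : h ∈ H)
    (hL : ∀ x ∈ H, LevelAt M h x) : M = V_ M.rank := by
  have level : ∀ v : ZFSet.{u}, (∀ z ∈ v, ∃ w ∈ h, w ∈ v ∧ w = V_ w.rank ∧ z ⊆ w) →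
      (∀ x ∈ H, ∀ w ∈ h, w ∈ v → x ⊆ w → x ∈ v) → v = V_ v.rank := by
    intro v h₁ h₂
    ext x
    rw [ZFSet.mem_vonNeumann]
    refine ⟨ZFSet.rank_lt_of_mem, fun hx => ?_⟩
    obtain ⟨z, hz, hxz⟩ := ZFSet.lt_rank_iff.1 hx
    obtain ⟨w, hw, hwv, he, hzw⟩ := h₁ z hz
    have hxw : x ⊆ w := by
      rw [he, ZFSet.subset_vonNeumann]
      exact hxz.trans (ZFSet.rank_mono hzw)
    exact h₂ x (hsub x w hxw (hH h hh w hw)) w hw hwv hxw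
  have hlev : ∀ v ∈ h, v = V_ v.rank := by
    intro v
    induction v using ZFSet.inductionOn with
    | _ v ih =>
      intro hv
      refine level v (fun z hz => ?_) fun x hx w hw hwv hxw => (hL x hx).2.2.1 v hv w hw hwv hxw
      obtain ⟨w, hw, hwv, hzw⟩ := (hL h hh).2.2.2 v hv z hz
      exact ⟨w, hw, hwv, ih w hwv hw, hzw⟩
  refine level M (fun z hz => ?_) fun x hx w hw _ hxw => (hL x hx).1 w hw hxw
  obtain ⟨w, hw, hzw⟩ := (hL h hh).2.1 z hz
  -- `w ∈ M` comes from the first clause applied to `w ⊆ w`.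
  exact ⟨w, hw, (hL w (hH h hh w hw)).1 w hw (fun _ h => h), hlev w hw, hzw⟩

theorem exists_sigma2_formula_reflection (Φ : setPredLang.Formula (Fin 1)) :
    ∃ φ : setLang.Formula (Fin 1), IsSigma2 φ ∧ ∀ H : Set ZFSet.{u}, TransClass H → ∀ p : H,
      (φ.Realize (fun _ => p) ↔ ∃ M ∈ H, ∃ h ∈ H, ∃ X ∈ H, ∀ x ∈ H, ∀ Y ∈ H,
        LevelAt M h x ∧ p.1 ∈ M ∧ PredHolds M X Y Φ fun _ => p.1) := by
  have hdef : Sigma2Def fun H (e : Fin 1 ⊕ Fin 0 → ZFSet.{u}) => ∃ M ∈ H, ∃ h ∈ H, ∃ X ∈ H,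
      ∀ x ∈ H, ∀ Y ∈ H, LevelAt M h x ∧ e (.inl 0) ∈ M ∧
        PredHolds M X Y Φ fun _ => e (.inl 0) :=
    .ex (.ex (.ex (Pi1Def.sigma2Def (.all (.all (Delta0Def.pi1Def ((delta0Def_levelAt _ _ _).and
      ((Delta0Def.mem _ _).and (delta0Def_predHolds Φ _ _ _ fun _ => _)))))))))
  obtain ⟨φ, hφ, hdef⟩ := hdef
  refine ⟨φ, hφ, fun H hH p => (realize_iff_holds H φ (fun _ => p) default).trans ?_⟩
  have h := hdef H hH (Sum.elim (fun _ => p.1) fun i => i.elim0) (by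
    rintro (i | i)
    · exact p.2
    · exact i.elim0)
  have e : (fun i : Fin 0 => ((default : Fin 0 → H) i).1) = fun i : Fin 0 =>
      Sum.elim (fun _ : Fin 1 => p.1) (fun i : Fin 0 => i.elim0) (Sum.inr i) :=
    funext fun i => i.elim0
  rw [e]
  exact h

theorem sigma12Reflection_of_sigma2Elementary {κ : Cardinal.{u}} (hκ : κ.IsInaccessible)
    (h : Sigma2Elementary (hered κ) (hered (Order.succ κ))) : Sigma12Reflection κ := by
  intro Φ p hp hsat
  obtain ⟨φ, hφ, hdef⟩ := exists_sigma2_formula_reflection.{u} Φ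
  obtain ⟨hsub, hel⟩ := h
  have hpκ : p ∈ hered κ := by rw [hered_eq_vonNeumann hκ]; exact hp
  have hV : V_ κ.ord ∈ hered (Order.succ κ) :=
    mem_hered_of_isTransitive (ZFSet.isTransitive_vonNeumann _)
      (by rw [card_vonNeumann_ord hκ]; exact Order.lt_succ κ)
  obtain ⟨X, hX, hXY⟩ := hsat.exists_predHolds
  obtain ⟨M, hM, h, hh, X, hX, H⟩ := (hdef _ (transClass_hered κ) ⟨p, hpκ⟩).1 <|
    (hel 1 φ hφ fun _ => ⟨p, hpκ⟩).2 <| (hdef _ (transClass_hered _) ⟨p, hsub hpκ⟩).2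
      -- The witnesses in `H_{κ⁺}` are `V_κ`, the set of all earlier levels, and the given `X`; the
      -- last two are subsets of `V_κ`.
      ⟨V_ κ.ord, hV, ZFSet.range fun a : Set.Iio κ.ord => V_ a.1,
        mem_hered_of_subset (fun y hy => by
          obtain ⟨a, rfl⟩ := ZFSet.mem_range.1 hy
          exact ZFSet.vonNeumann_mem_of_lt a.2) hV,
        X, mem_hered_of_subset hX hV, fun x _ Y _ => ⟨levelAt_vonNeumann _ x, hp, hXY Y⟩⟩
  have hMV : M = V_ M.rank := eq_vonNeumann_of_levelAt (transClass_hered κ)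
    -- The level clause does not involve `Y`, so `M` merely fills that place.
    (fun _ _ => mem_hered_of_subset) hh fun x hx => (H x hx M hM).1
  have hpM : p ∈ V_ M.rank := hMV ▸ (H M hM M hM).2.1
  refine ⟨M.rank, ?_, hpM, satSigma12_of_predHolds (X := X) fun Y hY => ?_⟩
  · rw [hered_eq_vonNeumann hκ] at hM
    exact ZFSet.mem_vonNeumann.1 hM
  · change PredHolds (V_ M.rank) X Y Φ fun _ => p
    rw [← hMV] at hY ⊢
    exact (H M hM Y (mem_hered_of_subset hY hM)).2.2

/-! ### First-order definability over `⟨M, ∈, X, Y⟩` -/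

/-- The property `Q` is uniformly first-order definable over the structures `⟨M, ∈, X, Y⟩` with `M`
transitive. -/
def PredDef {α : Type} (Q : ∀ M : Set ZFSet.{u}, Set M → Set M → (α → M) → Prop) : Prop :=
  ∃ Φ : setPredLang.Formula α, ∀ M : Set ZFSet.{u}, TransClass M → ∀ (X Y : Set M) (v : α → M),
    @Formula.Realize setPredLang _ (predStructure M X Y) _ Φ v ↔ Q M X Y v

/-- The binary relation `R` is uniformly first-order definable. -/
def PredRelDef (R : ∀ M : Set ZFSet.{u}, Set M → Set M → M → M → Prop) : Prop :=
  ∀ {α : Type} (i j : α), PredDef fun M X Y (v : α → M) => R M X Y (v i) (v j)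

namespace PredDef

variable {α : Type} {Q R : ∀ M : Set ZFSet.{u}, Set M → Set M → (α → M) → Prop}

theorem congr (hQ : PredDef Q)
    (h : ∀ M : Set ZFSet.{u}, TransClass M → ∀ X Y v, R M X Y v ↔ Q M X Y v) : PredDef R := by
  obtain ⟨Φ, H⟩ := hQ
  exact ⟨Φ, fun M hM X Y v => (H M hM X Y v).trans (h M hM X Y v).symm⟩

theorem mem (i j : α) : PredDef fun (M : Set ZFSet.{u}) _ _ (v : α → M) => (v i).1 ∈ (v j).1 :=
  ⟨Relations.formula₂ (L := setPredLang) SetPredRel.mem (.var i) (.var j),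
    fun _ _ _ _ _ => Iff.rfl⟩

theorem predX (i : α) : PredDef fun (M : Set ZFSet.{u}) X _ (v : α → M) => v i ∈ X :=
  ⟨Relations.formula₁ (L := setPredLang) SetPredRel.predX (.var i), fun _ _ _ _ _ => Iff.rfl⟩

theorem predY (i : α) : PredDef fun (M : Set ZFSet.{u}) _ Y (v : α → M) => v i ∈ Y :=
  ⟨Relations.formula₁ (L := setPredLang) SetPredRel.predY (.var i), fun _ _ _ _ _ => Iff.rfl⟩

theorem eq (i j : α) : PredDef fun (M : Set ZFSet.{u}) _ _ (v : α → M) => v i = v j :=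
  ⟨Term.equal (.var i) (.var j), fun M _ X Y v => by
    let := predStructure M X Y
    exact Formula.realize_equal⟩

theorem false : PredDef fun (M : Set ZFSet.{u}) _ _ (_ : α → M) => False :=
  ⟨⊥, fun _ _ _ _ _ => Iff.rfl⟩

theorem imp (hQ : PredDef Q) (hR : PredDef R) :
    PredDef fun M X Y v => Q M X Y v → R M X Y v := by
  obtain ⟨Φ, H⟩ := hQ
  obtain ⟨Ψ, K⟩ := hR
  exact ⟨Φ.imp Ψ, fun M hM X Y v => imp_congr (H M hM X Y v) (K M hM X Y v)⟩

theorem not (hQ : PredDef Q) : PredDef fun M X Y v => ¬ Q M X Y v := hQ.imp false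

theorem and (hQ : PredDef Q) (hR : PredDef R) : PredDef fun M X Y v => Q M X Y v ∧ R M X Y v :=
  (hQ.imp hR.not).not.congr fun _ _ _ _ _ => by tauto

theorem or (hQ : PredDef Q) (hR : PredDef R) : PredDef fun M X Y v => Q M X Y v ∨ R M X Y v :=
  (hQ.not.imp hR).congr fun _ _ _ _ _ => by tauto

theorem iff (hQ : PredDef Q) (hR : PredDef R) :
    PredDef fun M X Y v => Q M X Y v ↔ R M X Y v :=
  ((hQ.imp hR).and (hR.imp hQ)).congr fun _ _ _ _ _ => by tauto

theorem reindex {γ : Type} (hQ : PredDef Q) (g : α → γ) :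
    PredDef fun M X Y (v : γ → M) => Q M X Y fun i => v (g i) := by
  obtain ⟨Φ, H⟩ := hQ
  refine ⟨Φ.relabel g, fun M hM X Y v => ?_⟩
  let := predStructure M X Y
  rw [Formula.realize_relabel]
  exact H M hM X Y _

theorem exists_fun {ι : Type} [Finite ι]
    {S : ∀ M : Set ZFSet.{u}, Set M → Set M → (α → M) → (ι → M) → Prop}
    (hS : PredDef fun M X Y (v : α ⊕ ι → M) =>
      S M X Y (fun i => v (.inl i)) (fun i => v (.inr i))) :
    PredDef fun M X Y v => ∃ w, S M X Y v w := by
  obtain ⟨Φ, H⟩ := hS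
  refine ⟨Φ.iExs ι, fun M hM X Y v => ?_⟩
  let := predStructure M X Y
  rw [Formula.realize_iExs]
  exact exists_congr fun w => H M hM X Y (Sum.elim v w)

theorem ex {S : ∀ M : Set ZFSet.{u}, Set M → Set M → (α → M) → M → Prop}
    (hS : PredDef fun M X Y (v : Option α → M) => S M X Y (fun i => v (some i)) (v none)) :
    PredDef fun M X Y v => ∃ x, S M X Y v x := by
  refine (exists_fun (ι := Unit) (S := fun M X Y v w => S M X Y v (w ()))
    (hS.reindex fun i : Option α => (i.elim (Sum.inr ()) Sum.inl : α ⊕ Unit))).congr fun M _ X Y v => ?_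
  exact ⟨fun ⟨x, h⟩ => ⟨fun _ => x, h⟩, fun ⟨w, h⟩ => ⟨w (), h⟩⟩

theorem all {S : ∀ M : Set ZFSet.{u}, Set M → Set M → (α → M) → M → Prop}
    (hS : PredDef fun M X Y (v : Option α → M) => S M X Y (fun i => v (some i)) (v none)) :
    PredDef fun M X Y v => ∀ x, S M X Y v x :=
  (ex (S := fun M X Y v x => ¬ S M X Y v x) hS.not).not.congr fun _ _ _ _ _ => by simp

theorem forall_finite {ι : Type} [Finite ι]
    {S : ι → ∀ M : Set ZFSet.{u}, Set M → Set M → (α → M) → Prop} (hS : ∀ i, PredDef (S i)) :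
    PredDef fun M X Y v => ∀ i, S i M X Y v := by
  choose Φ H using hS
  refine ⟨Formula.iInf Φ, fun M hM X Y v => ?_⟩
  let := predStructure M X Y
  rw [Formula.realize_iInf]
  exact forall_congr' fun i => H i M hM X Y v

theorem eq_insert (i j k : α) : PredDef fun (M : Set ZFSet.{u}) _ _ (v : α → M) =>
    (v i).1 = {(v j).1, (v k).1} := by
  refine (all (S := fun M _ _ v x => x.1 ∈ (v i).1 ↔ x = v j ∨ x = v k)
    ((mem _ _).iff ((eq _ _).or (eq _ _)))).congr fun M hM X Y v => ?_
  rw [ZFSet.ext_iff]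
  simp only [ZFSet.mem_pair, Subtype.ext_iff]
  refine ⟨fun h x => h x.1, fun h x => ⟨fun hx => (h ⟨x, hM _ (v i).2 x hx⟩).1 hx, ?_⟩⟩
  rintro (rfl | rfl)
  · exact (h (v j)).2 (.inl rfl)
  · exact (h (v k)).2 (.inr rfl)

theorem eq_pair (i j k : α) : PredDef fun (M : Set ZFSet.{u}) _ _ (v : α → M) =>
    (v i).1 = ZFSet.pair (v j).1 (v k).1 := by
  refine (ex (S := fun M _ _ v a => ∃ b : M, a.1 = {(v j).1, (v j).1} ∧
      b.1 = {(v j).1, (v k).1} ∧ (v i).1 = {a.1, b.1})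
    (ex (S := fun M _ _ v b => (v none).1 = {(v (some j)).1, (v (some j)).1} ∧
      b.1 = {(v (some j)).1, (v (some k)).1} ∧ (v (some i)).1 = {(v none).1, b.1})
    ((eq_insert _ _ _).and ((eq_insert _ _ _).and (eq_insert _ _ _))))).congr
    fun M hM X Y v => ?_
  constructor
  · intro h
    refine ⟨⟨_, hM _ (v i).2 {(v j).1, (v j).1} ?_⟩, ⟨_, hM _ (v i).2 {(v j).1, (v k).1} ?_⟩,
      rfl, rfl, ?_⟩
    · rw [h, ZFSet.pair, ZFSet.mem_pair, ZFSet.pair_eq_singleton]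
      exact .inl rfl
    · rw [h, ZFSet.pair, ZFSet.mem_pair]
      exact .inr rfl
    · change (v i).1 = {{(v j).1, (v j).1}, {(v j).1, (v k).1}}
      rw [h, ZFSet.pair, ZFSet.pair_eq_singleton]
  · rintro ⟨a, b, ha, hb, h⟩
    rw [h, ha, hb, ZFSet.pair_eq_singleton]
    rfl

end PredDef

/-! ### Parameter tuples -/

/-- A code for a finite tuple of sets. -/
def tupleCode : ∀ {n : ℕ}, (Fin n → ZFSet.{u}) → ZFSet.{u}
  | 0, _ => ∅
  | _ + 1, a => ZFSet.pair (a 0) (tupleCode fun i => a i.succ)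

theorem tupleCode_injective {n : ℕ} : Function.Injective (tupleCode.{u} (n := n)) := by
  induction n with
  | zero => exact fun a b _ => funext fun i => i.elim0
  | succ n ih =>
    intro a b h
    obtain ⟨h₀, h₁⟩ := ZFSet.pair_inj.1 h
    funext i
    refine Fin.cases h₀ (fun i => ?_) i
    exact congrFun (ih h₁) i

theorem mem_of_pair_mem {M : Set ZFSet.{u}} (hM : TransClass M) {x y : ZFSet.{u}}
    (h : ZFSet.pair x y ∈ M) : x ∈ M ∧ y ∈ M := by
  have h' : ({x, y} : ZFSet.{u}) ∈ M := hM _ h _ (by rw [ZFSet.pair, ZFSet.mem_pair]; exact .inr rfl)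
  exact ⟨hM _ h' _ (ZFSet.mem_pair.2 (.inl rfl)), hM _ h' _ (ZFSet.mem_pair.2 (.inr rfl))⟩

theorem mem_of_tupleCode_mem {M : Set ZFSet.{u}} (hM : TransClass M) {n : ℕ}
    {a : Fin n → ZFSet.{u}} (h : tupleCode a ∈ M) (i : Fin n) : a i ∈ M := by
  induction n with
  | zero => exact i.elim0
  | succ n ih =>
    obtain ⟨h₀, h₁⟩ := mem_of_pair_mem hM h
    refine Fin.cases h₀ (fun i => ?_) i
    exact ih (a := fun i => a i.succ) h₁ i

theorem pair_mem_vonNeumann {o : Ordinal.{u}} (ho : Order.IsSuccLimit o) {x y : ZFSet.{u}}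
    (hx : x ∈ V_ o) (hy : y ∈ V_ o) : ZFSet.pair x y ∈ V_ o := by
  simp only [ZFSet.mem_vonNeumann] at *
  simp [ZFSet.pair, -Order.succ_eq_add_one, ho.succ_lt_iff, hx, hy]

theorem tupleCode_mem_vonNeumann {o : Ordinal.{u}} (ho : Order.IsSuccLimit o) {n : ℕ}
    {a : Fin n → ZFSet.{u}} (ha : ∀ i, a i ∈ V_ o) : tupleCode a ∈ V_ o := by
  induction n with
  | zero => simpa [tupleCode, ZFSet.mem_vonNeumann] using ho.bot_lt
  | succ n ih => exact pair_mem_vonNeumann ho (ha 0) (ih fun i => ha i.succ)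

theorem predDef_eq_tupleCode {α : Type} {n : ℕ} (i : α) (g : Fin n → α) :
    PredDef fun (M : Set ZFSet.{u}) _ _ (v : α → M) =>
      (v i).1 = tupleCode fun j => (v (g j)).1 := by
  induction n generalizing α with
  | zero =>
    refine (PredDef.all (S := fun M _ _ v x => ¬ x.1 ∈ (v i).1) (.not (.mem _ _))).congr
      fun M hM X Y v => ?_
    rw [tupleCode, ZFSet.eq_empty]
    exact ⟨fun h x => h x.1, fun h x hx => h ⟨x, hM _ (v i).2 x hx⟩ hx⟩
  | succ n ih =>
    refine (PredDef.ex (S := fun M _ _ v q => (v i).1 = ZFSet.pair (v (g 0)).1 q.1 ∧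
      q.1 = tupleCode fun j => (v (g j.succ)).1) (.and (.eq_pair _ _ _)
      (ih none fun j => some (g j.succ)))).congr fun M hM X Y v => ?_
    constructor
    · intro h
      have hmem : ZFSet.pair (v (g 0)).1 (tupleCode fun j => (v (g j.succ)).1) ∈ M := by
        have := (v i).2
        rwa [h] at this
      exact ⟨⟨_, (mem_of_pair_mem hM hmem).2⟩, h, rfl⟩
    · rintro ⟨q, h, hq⟩
      rw [h, hq]
      rfl

/-- Reflection allows a single parameter, so the tuple is coded by one set. Injectivity of the code
makes the tuple recovered in `V_ξ` the original one. The code also witnesses that `V_ξ` is nonempty,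
even for `n = 0`. -/
theorem Sigma12Reflection.exists_lt {κ : Cardinal.{u}} (h : Sigma12Reflection κ)
    (hκ : κ.IsInaccessible) {n : ℕ}
    {Q : ∀ M : Set ZFSet.{u}, Set M → Set M → (Fin n → M) → Prop} (hQ : PredDef Q)
    (a : Fin n → ZFSet.{u}) (ha : ∀ i, a i ∈ V_ κ.ord)
    (hsat : ∃ X, ∀ Y, Q (V_ κ.ord : ZFSet.{u}) X Y fun i => ⟨a i, ha i⟩) :
    ∃ ξ < κ.ord, (V_ ξ).Nonempty ∧ ∃ ha' : ∀ i, a i ∈ V_ ξ,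
      ∃ X, ∀ Y, Q (V_ ξ : ZFSet.{u}) X Y fun i => ⟨a i, ha' i⟩ := by
  have hdef : PredDef fun M X Y (v : Fin 1 → M) => ∃ w : Fin n → M,
      ((v 0).1 = tupleCode fun j => (w j).1) ∧ Q M X Y w :=
    .exists_fun (S := fun M X Y v w => ((v 0).1 = tupleCode fun j => (w j).1) ∧ Q M X Y w)
      ((predDef_eq_tupleCode (Sum.inl 0) Sum.inr).and (hQ.reindex Sum.inr))
  obtain ⟨Φ, hΦ⟩ := hdef
  have htr : ∀ o, TransClass (V_ o : ZFSet.{u}) := fun o =>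
    transClass_coe (ZFSet.isTransitive_vonNeumann o)
  obtain ⟨X, hX⟩ := hsat
  obtain ⟨ξ, hξ, hp, X, hX⟩ := h Φ (tupleCode a)
    (tupleCode_mem_vonNeumann (isSuccLimit_ord hκ.aleph0_lt.le) ha)
    ⟨X, fun Y => (hΦ _ (htr _) X Y _).2 ⟨_, rfl, hX Y⟩⟩
  refine ⟨ξ, hξ, ⟨_, hp⟩, mem_of_tupleCode_mem (htr ξ) hp, X, fun Y => ?_⟩
  obtain ⟨w, hw, H⟩ := (hΦ _ (htr _) X Y _).1 (hX Y)
  have : w = fun i => ⟨a i, mem_of_tupleCode_mem (htr ξ) hp i⟩ :=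
    funext fun i => Subtype.ext (congrFun (tupleCode_injective hw.symm) i)
  exact this ▸ H

/-! ### Coded structures -/

/-- The binary relation coded by a predicate. -/
def codedRel {M : Set ZFSet.{u}} (X : Set M) (x y : M) : Prop :=
  ∃ w : M, w ∈ X ∧ w.1 = ZFSet.pair x.1 y.1

/-- Closure under ordered pairs. -/
def PairClosed (M : Set ZFSet.{u}) : Prop := ∀ x y : M, ∃ w : M, w.1 = ZFSet.pair x.1 y.1

/-- `⟨M, E⟩` end-extends the image of `⟨M, R⟩` under `x ↦ ⟨x, x⟩`, up to coextensionality. -/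
def EndExt {M : Set ZFSet.{u}} (R E : M → M → Prop) : Prop :=
  ∀ x y : M, y.1 = ZFSet.pair x.1 x.1 →
    (∀ z, E z y → ∃ x' y' : M, y'.1 = ZFSet.pair x'.1 x'.1 ∧ R x' x ∧ Coext E z y') ∧
      ∀ x' y' : M, y'.1 = ZFSet.pair x'.1 x'.1 → R x' x → E y' y

/-- Every nonempty element of `M` has an `E`-minimal element. -/
def InnerWellFounded {M : Set ZFSet.{u}} (E : M → M → Prop) : Prop :=
  ∀ b : M, (∃ x : M, x.1 ∈ b.1) → ∃ x : M, x.1 ∈ b.1 ∧ ∀ y : M, y.1 ∈ b.1 → ¬ E y x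

/-- If `X` codes a well-founded extension of `⟨M, ∈⟩` and `Y` an extension of it that looks
well-founded, then the structure coded by `Y` satisfies `π` of `a` and of some elements of the
structure coded by `X`. -/
def CodedSat {n k : ℕ} (π : setLang.BoundedFormula (Fin n) k) (M : Set ZFSet.{u}) (X Y : Set M)
    (a : Fin n → M) : Prop :=
  (CoextCongr (codedRel Y) → EndExt (codedRel X) (codedRel Y) → InnerWellFounded (codedRel Y) →
    ∃ b c : Fin n → M, ∃ xs ys : Fin k → M, (∀ i, (b i).1 = ZFSet.pair (a i).1 (a i).1) ∧
      (∀ i, (c i).1 = ZFSet.pair (b i).1 (b i).1) ∧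
      (∀ i, (ys i).1 = ZFSet.pair (xs i).1 (xs i).1) ∧
      Sat (codedRel Y) (Coext (codedRel Y)) Set.univ π c ys)

/-- The `Σ¹₂` matrix used for reflecting `∃ xs, π a xs`. -/
def ReflectMatrix {n k : ℕ} (π : setLang.BoundedFormula (Fin n) k) (M : Set ZFSet.{u})
    (X Y : Set M) (a : Fin n → M) : Prop :=
  PairClosed M ∧ CoextCongr (codedRel X) ∧ EndExt (fun x y : M => x.1 ∈ y.1) (codedRel X) ∧
    ((∃ x, x ∈ Y) → ∃ x, x ∈ Y ∧ ∀ y, y ∈ Y → ¬ codedRel X y x) ∧ CodedSat π M X Y a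

section CodedDefinability

variable {α : Type} {R E : ∀ M : Set ZFSet.{u}, Set M → Set M → M → M → Prop}

theorem predRelDef_codedRel_X : PredRelDef.{u} fun _ X _ => codedRel X := fun i j =>
  .ex (S := fun _ X _ v w => w ∈ X ∧ w.1 = ZFSet.pair (v i).1 (v j).1)
    (.and (.predX _) (.eq_pair _ _ _))

theorem predRelDef_codedRel_Y : PredRelDef.{u} fun _ _ Y => codedRel Y := fun i j =>
  .ex (S := fun _ _ Y v w => w ∈ Y ∧ w.1 = ZFSet.pair (v i).1 (v j).1)
    (.and (.predY _) (.eq_pair _ _ _))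

theorem PredRelDef.coext (hE : PredRelDef E) :
    PredRelDef fun M X Y => Coext (E M X Y) := fun i j =>
  .all (S := fun M X Y v w => E M X Y w (v i) ↔ E M X Y w (v j)) (.iff (hE _ _) (hE _ _))

theorem predDef_pairClosed : PredDef fun (M : Set ZFSet.{u}) _ _ (_ : α → M) => PairClosed M :=
  .all (S := fun M _ _ _ x => ∀ y : M, ∃ w : M, w.1 = ZFSet.pair x.1 y.1)
    (.all (S := fun M _ _ v y => ∃ w : M, w.1 = ZFSet.pair (v none).1 y.1)
    (.ex (S := fun _ _ _ v w => w.1 = ZFSet.pair (v (some none)).1 (v none).1)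
    (.eq_pair _ _ _)))

theorem PredRelDef.coextCongr (hE : PredRelDef E) :
    PredDef fun M X Y (_ : α → M) => CoextCongr (E M X Y) :=
  .all (S := fun M X Y _ x => ∀ y, Coext (E M X Y) x y → ∀ w, E M X Y x w → E M X Y y w)
    (.all (S := fun M X Y v y => Coext (E M X Y) (v none) y →
      ∀ w, E M X Y (v none) w → E M X Y y w)
    (.imp (hE.coext _ _) (.all (S := fun M X Y v w => E M X Y (v (some none)) w →
      E M X Y (v none) w) (.imp (hE _ _) (hE _ _)))))

theorem PredRelDef.endExt (hR : PredRelDef R) (hE : PredRelDef E) :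
    PredDef fun M X Y (_ : α → M) => EndExt (R M X Y) (E M X Y) := by
  refine .all (S := fun M X Y _ x => ∀ y : M, y.1 = ZFSet.pair x.1 x.1 →
    (∀ z, E M X Y z y → ∃ x' y' : M, y'.1 = ZFSet.pair x'.1 x'.1 ∧ R M X Y x' x ∧
      Coext (E M X Y) z y') ∧
      ∀ x' y' : M, y'.1 = ZFSet.pair x'.1 x'.1 → R M X Y x' x → E M X Y y' y) ?_
  refine .all (S := fun M X Y v y => y.1 = ZFSet.pair (v none).1 (v none).1 →
    (∀ z, E M X Y z y → ∃ x' y' : M, y'.1 = ZFSet.pair x'.1 x'.1 ∧ R M X Y x' (v none) ∧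
      Coext (E M X Y) z y') ∧
      ∀ x' y' : M, y'.1 = ZFSet.pair x'.1 x'.1 → R M X Y x' (v none) → E M X Y y' y) ?_
  refine .imp (.eq_pair _ _ _) (.and ?_ ?_)
  · refine .all (S := fun M X Y v z => E M X Y z (v none) → ∃ x' y' : M,
      y'.1 = ZFSet.pair x'.1 x'.1 ∧ R M X Y x' (v (some none)) ∧ Coext (E M X Y) z y')
      (.imp (hE _ _) ?_)
    refine .ex (S := fun M X Y v x' => ∃ y' : M, y'.1 = ZFSet.pair x'.1 x'.1 ∧
      R M X Y x' (v (some (some none))) ∧ Coext (E M X Y) (v none) y') ?_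
    exact .ex (S := fun M X Y v y' => y'.1 = ZFSet.pair (v none).1 (v none).1 ∧
      R M X Y (v none) (v (some (some (some none)))) ∧ Coext (E M X Y) (v (some none)) y')
      (.and (.eq_pair _ _ _) (.and (hR _ _) (hE.coext _ _)))
  · refine .all (S := fun M X Y v x' => ∀ y' : M, y'.1 = ZFSet.pair x'.1 x'.1 →
      R M X Y x' (v (some none)) → E M X Y y' (v none)) ?_
    exact .all (S := fun M X Y v y' => y'.1 = ZFSet.pair (v none).1 (v none).1 →
      R M X Y (v none) (v (some (some none))) → E M X Y y' (v (some none)))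
      (.imp (.eq_pair _ _ _) (.imp (hR _ _) (hE _ _)))

theorem PredRelDef.innerWellFounded (hE : PredRelDef E) :
    PredDef fun M X Y (_ : α → M) => InnerWellFounded (E M X Y) := by
  refine .all (S := fun M X Y _ b => (∃ x : M, x.1 ∈ b.1) → ∃ x : M, x.1 ∈ b.1 ∧
    ∀ y : M, y.1 ∈ b.1 → ¬ E M X Y y x) (.imp ?_ ?_)
  · exact .ex (S := fun M _ _ v x => x.1 ∈ (v none).1) (.mem _ _)
  · refine .ex (S := fun M X Y v x => x.1 ∈ (v none).1 ∧
      ∀ y : M, y.1 ∈ (v none).1 → ¬ E M X Y y x) (.and (.mem _ _) ?_)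
    exact .all (S := fun M X Y v y => y.1 ∈ (v (some none)).1 → ¬ E M X Y y (v none))
      (.imp (.mem _ _) (.not (hE _ _)))

/-- Truth of one fixed formula in a coded structure is first order, by recursion on the formula;
coextensionality, which replaces equality, is itself first order. -/
theorem PredRelDef.sat (hE : PredRelDef E) {γ : Type} {n : ℕ} (φ : setLang.BoundedFormula γ n)
    (g : γ ⊕ Fin n → α) :
    PredDef fun M X Y (v : α → M) => Sat (E M X Y) (Coext (E M X Y)) Set.univ φ
      (fun i => v (g (.inl i))) (fun i => v (g (.inr i))) := by
  have key : ∀ {β : Type (u + 1)} {n : ℕ} (h : γ ⊕ Fin n → β) (i : γ ⊕ Fin n),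
      Sum.elim (fun i => h (.inl i)) (fun i => h (.inr i)) i = h i := by
    intro β n h i
    cases i <;> rfl
  induction φ generalizing α with
  | falsum => exact .false
  | equal t s =>
    refine (hE.coext (g (termVar t)) (g (termVar s))).congr fun M _ X Y v => ?_
    change Coext (E M X Y) _ _ ↔ _
    rw [key fun i => v (g i), key fun i => v (g i)]
  | rel r ts =>
    cases r
    refine (hE (g (termVar (ts 0))) (g (termVar (ts 1)))).congr fun M _ X Y v => ?_
    change E M X Y _ _ ↔ _
    rw [key fun i => v (g i), key fun i => v (g i)]
  | imp φ ψ ih₁ ih₂ => exact (ih₁ g).imp (ih₂ g)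
  | all φ ih =>
    refine (PredDef.all (S := fun M X Y v x => Sat (E M X Y) (Coext (E M X Y)) Set.univ φ
      (fun i => v (g (.inl i))) (Fin.snoc (fun i => v (g (.inr i))) x))
      ((ih (extendVal (fun i => some (g i)) none)).congr fun M _ X Y v => ?_)).congr
      fun M _ X Y v => ?_
    · have : (Fin.snoc (fun i => v (some (g (.inr i)))) (v none) : Fin _ → M) =
          fun i => v (extendVal (fun i => some (g i)) none (Sum.inr i)) := by
        funext i
        refine Fin.lastCases ?_ (fun i => ?_) i <;> simp [extendVal]
      rw [this]
      exact Iff.rfl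
    · exact forall_congr' fun x => by simp

end CodedDefinability

theorem predDef_reflectMatrix {n k : ℕ} (π : setLang.BoundedFormula (Fin n) k) :
    PredDef.{u} (ReflectMatrix π) := by
  refine .and predDef_pairClosed (.and predRelDef_codedRel_X.coextCongr (.and
    (PredRelDef.endExt (fun _ _ => .mem _ _) predRelDef_codedRel_X) (.and (.imp ?_ ?_)
    (.imp predRelDef_codedRel_Y.coextCongr (.imp
      (predRelDef_codedRel_X.endExt predRelDef_codedRel_Y)
      (.imp predRelDef_codedRel_Y.innerWellFounded ?_))))))
  · exact .ex (S := fun M _ Y _ x => x ∈ Y) (.predY _)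
  · refine .ex (S := fun M X Y v x => x ∈ Y ∧ ∀ y, y ∈ Y → ¬ codedRel X y x) (.and (.predY _) ?_)
    exact .all (S := fun M X Y v y => y ∈ Y → ¬ codedRel X y (v none))
      (.imp (.predY _) (.not (predRelDef_codedRel_X _ _)))
  · refine .exists_fun (S := fun M X Y a b => ∃ c : Fin n → M, ∃ xs ys : Fin k → M,
      (∀ i, (b i).1 = ZFSet.pair (a i).1 (a i).1) ∧
      (∀ i, (c i).1 = ZFSet.pair (b i).1 (b i).1) ∧
      (∀ i, (ys i).1 = ZFSet.pair (xs i).1 (xs i).1) ∧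
      Sat (codedRel Y) (Coext (codedRel Y)) Set.univ π c ys) ?_
    refine .exists_fun (S := fun M X Y (v : Fin n ⊕ Fin n → M) c => ∃ xs ys : Fin k → M,
      (∀ i : Fin n, (v (Sum.inr i)).1 = ZFSet.pair (v (Sum.inl i)).1 (v (Sum.inl i)).1) ∧
      (∀ i, (c i).1 = ZFSet.pair (v (Sum.inr i)).1 (v (Sum.inr i)).1) ∧
      (∀ i, (ys i).1 = ZFSet.pair (xs i).1 (xs i).1) ∧
      Sat (codedRel Y) (Coext (codedRel Y)) Set.univ π c ys) ?_
    refine .exists_fun (S := fun M X Y (v : (Fin n ⊕ Fin n) ⊕ Fin n → M) xs => ∃ ys : Fin k → M,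
      (∀ i : Fin n, (v (Sum.inl (Sum.inr i))).1 = ZFSet.pair (v (Sum.inl (Sum.inl i))).1 (v (Sum.inl (Sum.inl i))).1) ∧
      (∀ i : Fin n, (v (Sum.inr i)).1 = ZFSet.pair (v (Sum.inl (Sum.inr i))).1 (v (Sum.inl (Sum.inr i))).1) ∧
      (∀ i, (ys i).1 = ZFSet.pair (xs i).1 (xs i).1) ∧
      Sat (codedRel Y) (Coext (codedRel Y)) Set.univ π (fun i => v (Sum.inr i)) ys) ?_
    refine .exists_fun (S := fun M X Y (v : ((Fin n ⊕ Fin n) ⊕ Fin n) ⊕ Fin k → M) ys =>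
      (∀ i : Fin n, (v (Sum.inl (Sum.inl (Sum.inr i)))).1 =
        ZFSet.pair (v (Sum.inl (Sum.inl (Sum.inl i)))).1 (v (Sum.inl (Sum.inl (Sum.inl i)))).1) ∧
      (∀ i : Fin n, (v (Sum.inl (Sum.inr i))).1 =
        ZFSet.pair (v (Sum.inl (Sum.inl (Sum.inr i)))).1 (v (Sum.inl (Sum.inl (Sum.inr i)))).1) ∧
      (∀ i, (ys i).1 = ZFSet.pair (v (Sum.inr i)).1 (v (Sum.inr i)).1) ∧
      Sat (codedRel Y) (Coext (codedRel Y)) Set.univ π (fun i => v (Sum.inl (Sum.inr i))) ys) ?_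
    refine .and (.forall_finite fun i => .eq_pair _ _ _) (.and (.forall_finite fun i =>
      .eq_pair _ _ _) (.and (.forall_finite fun i => .eq_pair _ _ _) ?_))
    exact predRelDef_codedRel_Y.sat π
      (Sum.elim (fun i => Sum.inl (Sum.inl (Sum.inr i))) fun i => Sum.inr i :
        Fin n ⊕ Fin k → (((Fin n ⊕ Fin n) ⊕ Fin n) ⊕ Fin k) ⊕ Fin k)

instance small_coe_set (x : ZFSet.{u}) : Small.{u} ↥(x : Set ZFSet.{u}) :=
  inferInstanceAs (Small.{u} ↥x)

/-! ### Coding and decoding -/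

section Coding

variable {M : Set ZFSet.{u}} {R E : M → M → Prop} {f g : M → ZFSet.{u}}

theorem PairClosed.exists_codedRel_eq (hM : PairClosed M) (E : M → M → Prop) :
    ∃ X : Set M, codedRel X = E := by
  refine ⟨{w | ∃ x y, E x y ∧ w.1 = ZFSet.pair x.1 y.1}, ?_⟩
  funext x y
  refine propext ⟨?_, fun h => ?_⟩
  · rintro ⟨w, ⟨x', y', h, hw⟩, hw'⟩
    obtain ⟨hx, hy⟩ := ZFSet.pair_inj.1 (hw.symm.trans hw')
    exact Subtype.ext hx ▸ Subtype.ext hy ▸ h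
  · obtain ⟨w, hw⟩ := hM x y
    exact ⟨w, ⟨x, y, h, hw⟩, hw⟩

theorem endExt_of_isCollapse (hM : PairClosed M) (hR : IsCollapse R f) (hE : IsCollapse E g)
    (hcE : CoextCongr E) (h : ∀ x y : M, y.1 = ZFSet.pair x.1 x.1 → g y = f x) :
    EndExt R E := by
  refine fun x y hy => ⟨fun z hz => ?_, fun x' y' hy' hx => ?_⟩
  · have hz' := hE.mem_of_rel hz
    rw [h x y hy, hR] at hz'
    obtain ⟨x', hx', e⟩ := hz'
    obtain ⟨y', hy'⟩ := hM x' x'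
    exact ⟨x', y', hy', hx', (hE.coext_iff hcE).2 (by rw [h x' y' hy', e])⟩
  · rw [hE.rel_iff hcE, h x y hy, h x' y' hy']
    exact hR.mem_of_rel hx

/-- By induction along `R`: up to coextensionality the `E`-predecessors of `⟨x, x⟩` are exactly the
pairs `⟨x', x'⟩` with `R x' x`. So the first-order condition `EndExt` forces the second collapse to
extend the first. -/
theorem EndExt.collapse_eq (hend : EndExt R E) (hM : PairClosed M) (hR : IsCollapse R f)
    (hE : IsCollapse E g) (x y : M) (hy : y.1 = ZFSet.pair x.1 x.1) : g y = f x := by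
  induction x using hR.wellFounded.induction generalizing y with
  | _ x ih =>
    ext z
    rw [hE, hR]
    constructor
    · rintro ⟨w, hw, rfl⟩
      obtain ⟨x', y', hy', hx', hco⟩ := (hend x y hy).1 w hw
      exact ⟨x', hx', by rw [hE.eq_of_coext hco, ih x' hx' y' hy']⟩
    · rintro ⟨x', hx', rfl⟩
      obtain ⟨y', hy'⟩ := hM x' x'
      exact ⟨y', (hend x y hy).2 x' y' hy' hx', ih x' hx' y' hy'⟩

theorem isCollapse_val (hM : TransClass M) :
    IsCollapse (fun x y : M => x.1 ∈ y.1) Subtype.val :=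
  fun y z => ⟨fun h => ⟨⟨z, hM _ y.2 z h⟩, h, rfl⟩, fun ⟨_, h, e⟩ => e ▸ h⟩

theorem IsCollapse.innerWellFounded (hE : IsCollapse E f) : InnerWellFounded E := by
  intro b hb
  obtain ⟨x, hx, h⟩ := hE.wellFounded.has_min {x : M | x.1 ∈ b.1} hb
  exact ⟨x, hx, h⟩

end Coding

/-- A finite nonempty set has an element `x` of maximal rank, but `⟨x, x⟩` has larger rank. Infinity
is needed for Löwenheim–Skolem with bound `|V_ξ|`. -/
theorem PairClosed.aleph0_le_card {M : ZFSet.{u}} (hM : PairClosed (M : Set ZFSet.{u}))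
    (hne : M.Nonempty) : ℵ₀ ≤ M.card := by
  by_contra! h
  rw [← lift_lt.{u, u + 1}, ← ZFSet.cardinalMk_coe_sort, lift_aleph0, lt_aleph0_iff_finite] at h
  have : Finite (M : Set ZFSet.{u}) := h
  have : Nonempty (M : Set ZFSet.{u}) := ⟨⟨_, hne.choose_spec⟩⟩
  obtain ⟨x, hx⟩ := Finite.exists_max fun x : (M : Set ZFSet.{u}) => x.1.rank
  obtain ⟨y, hy⟩ := hM x x
  have h₁ : ({x.1} : ZFSet.{u}) ∈ y.1 := by rw [hy, ZFSet.pair, ZFSet.mem_pair]; exact .inl rfl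
  exact (((ZFSet.rank_lt_of_mem (ZFSet.mem_singleton.2 rfl)).trans
    (ZFSet.rank_lt_of_mem h₁)).trans_le (hx y)).false

theorem pair_self_ne (x : ZFSet.{u}) : ZFSet.pair x x ≠ x := by
  intro h
  have h₁ : ({x} : ZFSet.{u}) ∈ ZFSet.pair x x := by rw [ZFSet.pair, ZFSet.mem_pair]; exact .inl rfl
  have h₂ := (ZFSet.rank_lt_of_mem (ZFSet.mem_singleton.2 rfl : x ∈ ({x} : ZFSet.{u}))).trans
    (ZFSet.rank_lt_of_mem h₁)
  rw [h] at h₂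
  exact h₂.false

/-- A set that is not larger than `M` is the image of `M` under a function with prescribed values at
the pairs `⟨x, x⟩`. -/
theorem PairClosed.exists_surjective {M T : ZFSet.{u}} (hM : PairClosed (M : Set ZFSet.{u}))
    (hc : T.card ≤ M.card) (hT : T.Nonempty) {f : ↥(M : Set ZFSet.{u}) → ZFSet.{u}}
    (hf : ∀ x, f x ∈ T) : ∃ g : ↥(M : Set ZFSet.{u}) → ZFSet.{u}, (∀ x, g x ∈ T) ∧
      (∀ t ∈ T, ∃ x, g x = t) ∧ ∀ x y : (M : Set ZFSet.{u}), y.1 = ZFSet.pair x.1 x.1 →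
        g y = f x := by
  classical
  obtain ⟨e, heT, hes⟩ : ∃ e : ↥(M : Set ZFSet.{u}) → ZFSet.{u}, (∀ a, e a ∈ T) ∧
    ∀ b ∈ T, ∃ a, e a = b := exists_surjective_of_card_le hc hT
  -- Diagonal pairs carry the prescribed values, and other pairs `⟨x, y⟩` carry `e x`. Surjectivity
  -- survives because `⟨a, ⟨a, a⟩⟩` is never diagonal, by foundation.
  let g : ↥(M : Set ZFSet.{u}) → ZFSet.{u} := fun w =>
    if h : ∃ x : (M : Set ZFSet.{u}), w.1 = ZFSet.pair x.1 x.1 then f h.choose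
    else if h : ∃ x : (M : Set ZFSet.{u}), ∃ y, w.1 = ZFSet.pair x.1 y then e h.choose
    else e w
  refine ⟨g, fun w => ?_, fun t ht => ?_, fun x y hy => ?_⟩
  · simp only [g]
    split_ifs
    exacts [hf _, heT _, heT _]
  · obtain ⟨a, rfl⟩ := hes t ht
    obtain ⟨b, hb⟩ := hM a a
    obtain ⟨c, hc⟩ := hM a b
    have h₁ : ¬ ∃ x : (M : Set ZFSet.{u}), c.1 = ZFSet.pair x.1 x.1 := by
      rintro ⟨x, hx⟩
      obtain ⟨h, h'⟩ := ZFSet.pair_inj.1 (hc.symm.trans hx)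
      exact pair_self_ne a.1 (hb.symm.trans (h'.trans h.symm))
    have h₂ : ∃ x : (M : Set ZFSet.{u}), ∃ y, c.1 = ZFSet.pair x.1 y := ⟨a, _, hc⟩
    refine ⟨c, ?_⟩
    simp only [g]
    rw [dif_neg h₁, dif_pos h₂]
    obtain ⟨y, hy⟩ := h₂.choose_spec
    exact congrArg e (Subtype.ext (ZFSet.pair_inj.1 (hy.symm.trans hc)).1)
  · have h : ∃ x : (M : Set ZFSet.{u}), y.1 = ZFSet.pair x.1 x.1 := ⟨x, hy⟩
    simp only [g]
    rw [dif_pos h]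
    exact congrArg f (Subtype.ext (ZFSet.pair_inj.1 (h.choose_spec.symm.trans hy)).1)

/-- The range of a descending sequence is a countable subset of `V_κ`, hence an element of `V_κ` by
regularity and uncountability, and the inner condition applies to it. -/
theorem InnerWellFounded.wellFounded {κ : Cardinal.{u}} (hκ : κ.IsInaccessible)
    {E : ↥(V_ κ.ord : Set ZFSet.{u}) → ↥(V_ κ.ord : Set ZFSet.{u}) → Prop}
    (h : InnerWellFounded E) : WellFounded E := by
  refine wellFounded_iff_isEmpty_descending_chain.2 ⟨fun ⟨s, hs⟩ => ?_⟩
  have hb : ZFSet.range (fun n => (s n).1) ∈ V_ κ.ord := by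
    rw [ZFSet.mem_vonNeumann]
    refine rank_lt_of_card_lt hκ (lt_of_le_of_lt ?_ hκ.aleph0_lt) fun y hy => ?_
    · simpa using ZFSet.lift_card_range_le (f := fun n => (s n).1)
    · obtain ⟨n, rfl⟩ := ZFSet.mem_range.1 hy
      exact ZFSet.mem_vonNeumann.1 (s n).2
  obtain ⟨x, hx, hmin⟩ := h ⟨_, hb⟩ ⟨s 0, ZFSet.mem_range_self _⟩
  obtain ⟨n, hn⟩ := ZFSet.mem_range.1 hx
  have : s n = x := Subtype.ext hn
  exact hmin (s (n + 1)) (ZFSet.mem_range_self _) (this ▸ hs n)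

/-! ### `Σ₂` elementarity from reflection -/

theorem coe_subset_hered {κ : Cardinal.{u}} {t : ZFSet.{u}} (ht : t.IsTransitive)
    (h : t.card < κ) : (t : Set ZFSet.{u}) ⊆ hered κ := fun x hx =>
  transClass_hered κ t (mem_hered_of_isTransitive ht h) x hx

theorem lift_le_mk_hered {κ μ c : Cardinal.{u}} (hκ : κ.IsInaccessible) (hμ : κ ≤ μ) (hc : c ≤ κ) :
    lift.{u + 1} c ≤ #(hered μ) := by
  refine le_trans ?_ (mk_le_mk_of_subset (hered_mono hμ))
  rw [hered_eq_vonNeumann hκ]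
  refine (lift_le.2 hc).trans ?_
  conv_lhs => rw [← card_vonNeumann_ord hκ, ← ZFSet.cardinalMk_coe_sort]
  exact le_rfl

theorem IsPi1.holds_hered_succ {κ : Cardinal.{u}} (hκ : κ.IsInaccessible) {n k : ℕ}
    {π : setLang.BoundedFormula (Fin n) k} (hπ : IsPi1 π) {a : Fin n → ZFSet.{u}}
    (ha : ∀ i, a i ∈ hered κ) {xs : Fin k → ZFSet.{u}} (hxs : ∀ i, xs i ∈ hered κ)
    (h : Holds (hered κ) π a xs) : Holds (hered (Order.succ κ)) π a xs := by
  obtain ⟨T₁, hT₁, -, haT, hT₁c⟩ := exists_isTransitive_superset hκ.aleph0_lt.le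
    ZFSet.isTransitive_empty (by simpa using hκ.pos) a ha
  obtain ⟨T₀, hT₀, hsub, hxT, hT₀c⟩ :=
    exists_isTransitive_superset hκ.aleph0_lt.le hT₁ hT₁c xs hxs
  -- Löwenheim–Skolem needs an infinite bound; since `κ` is uncountable, `ℵ₀` can be included.
  have hc := max_lt hκ.aleph0_lt hT₀c
  obtain ⟨T, hT, hT₀T, hTc, hrefl⟩ := exists_transitive_reflecting (transClass_hered (Order.succ κ))
    hT₀ ((coe_subset_hered hT₀ hT₀c).trans (hered_mono (Order.le_succ κ))) (le_max_left _ T₀.card)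
    (le_max_right _ _) (lift_le_mk_hered hκ (Order.le_succ κ) hc.le)
  exact (hrefl π a xs (fun i => hsub (haT i)) hxT).1
    (hπ.holds_of_subset (transClass_coe hT) (coe_subset_hered hT (hTc.trans_lt hc))
      (fun i => hT₀T (hsub (haT i))) (fun i => hT₀T (hxT i)) h)

theorem IsPi1.exists_reflectMatrix {κ : Cardinal.{u}} (hκ : κ.IsInaccessible) {n k : ℕ}
    {π : setLang.BoundedFormula (Fin n) k} (hπ : IsPi1 π) {a : Fin n → ZFSet.{u}}
    (ha : ∀ i, a i ∈ V_ κ.ord) {xs : Fin k → ZFSet.{u}} (hxs : ∀ i, xs i ∈ hered (Order.succ κ))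
    (h : Holds (hered (Order.succ κ)) π a xs) :
    ∃ X, ∀ Y, ReflectMatrix π (V_ κ.ord : ZFSet.{u}) X Y fun i => ⟨a i, ha i⟩ := by
  have hVt := ZFSet.isTransitive_vonNeumann κ.ord
  have hVc := card_vonNeumann_ord hκ
  have hlim := isSuccLimit_ord hκ.aleph0_lt.le
  have hpc : PairClosed (V_ κ.ord : Set ZFSet.{u}) := fun x y =>
    ⟨⟨_, pair_mem_vonNeumann hlim x.2 y.2⟩, rfl⟩
  obtain ⟨T₀, hT₀, hVT, hxT, hT₀c⟩ := exists_isTransitive_superset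
    (hκ.aleph0_lt.le.trans (Order.le_succ κ)) hVt (hVc.trans_lt (Order.lt_succ κ)) xs hxs
  -- `X` will code `T₀`, a transitive set of size at most `κ` including `V_κ` and containing `xs`,
  -- with each `x ∈ V_κ` represented by `⟨x, x⟩`.
  obtain ⟨f, hfT, hfs, hfp⟩ := hpc.exists_surjective (T := T₀)
    ((Order.lt_succ_iff.1 hT₀c).trans_eq hVc.symm)
    ⟨∅, hVT (by simpa [ZFSet.mem_vonNeumann] using hlim.bot_lt)⟩ (f := Subtype.val)
    fun x => hVT x.2
  have hf := IsCollapse.of_surjective hT₀ hfT hfs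
  obtain ⟨X, hX⟩ := hpc.exists_codedRel_eq fun x y => f x ∈ f y
  rw [← hX] at hf
  refine ⟨X, fun Y => ⟨hpc, ?_, ?_, hf.wellFounded.has_min Y, fun hcong hend hin => ?_⟩⟩
  · rw [hX] at hf ⊢
    exact hf.coextCongr_of_mem
  · refine endExt_of_isCollapse hpc (isCollapse_val (transClass_coe hVt)) hf ?_ hfp
    rw [hX] at hf ⊢
    exact hf.coextCongr_of_mem
  · obtain ⟨g, hg⟩ := exists_isCollapse.{u} (hin.wellFounded hκ)
    have hgf := hend.collapse_eq hpc hf hg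
    -- The parameters pass through two extensions and so are paired twice; the witnesses already
    -- live in the structure of `X` and are paired once.
    choose b hb using fun i => hpc ⟨a i, ha i⟩ ⟨a i, ha i⟩
    choose c hc using fun i => hpc (b i) (b i)
    choose ys hys using fun i => hfs (xs i) (hxT i)
    choose zs hzs using fun i => hpc (ys i) (ys i)
    refine ⟨b, c, ys, zs, hb, hc, hzs, (hg.sat_iff hcong π c zs).2 ?_⟩
    have h₁ : (fun i => g (c i)) = a := funext fun i => by
      rw [hgf _ _ (hc i), hfp _ _ (hb i)]
    have h₂ : (fun i => g (zs i)) = xs := funext fun i => by rw [hgf _ _ (hzs i), hys]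
    have hgc : (ZFSet.range g).card < Order.succ κ := by
      exact Order.lt_succ_iff.2 ((card_le_of_surjective (A := V_ κ.ord) g
        fun b hb => ZFSet.mem_range.1 hb).trans_eq hVc)
    have hmem : ∀ x, g x ∈ (ZFSet.range g : Set ZFSet.{u}) := fun x => ZFSet.mem_range_self x
    rw [h₁, h₂]
    exact hπ.holds_of_subset (transClass_coe hg.isTransitive_range)
      (coe_subset_hered hg.isTransitive_range hgc) (fun i => h₁ ▸ hmem _) (fun i => h₂ ▸ hmem _) h

theorem exists_holds_of_reflectMatrix {κ : Cardinal.{u}} (hκ : κ.IsInaccessible) {n k : ℕ}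
    {π : setLang.BoundedFormula (Fin n) k} {ξ : Ordinal.{u}} (hξ : ξ < κ.ord)
    (hne : (V_ ξ).Nonempty) {a : Fin n → ZFSet.{u}} (ha : ∀ i, a i ∈ V_ ξ)
    {X : Set (V_ ξ : Set ZFSet.{u})}
    (hX : ∀ Y, ReflectMatrix π (V_ ξ : ZFSet.{u}) X Y fun i => ⟨a i, ha i⟩) :
    ∃ xs : Fin k → hered κ, Holds (hered κ) π a fun i => (xs i).1 := by
  have hVt := ZFSet.isTransitive_vonNeumann ξ
  -- The clauses kept here do not depend on `Y`, so any instance serves.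
  obtain ⟨hpc, hcX, hendX, -, -⟩ := hX ∅
  have hwf : WellFounded (codedRel X) :=
    -- Here `Y` acts as an arbitrary subset; below it acts as a code.
    WellFounded.wellFounded_iff_has_min.2 fun Y hY => (hX Y).2.2.2.1 hY
  obtain ⟨f, hf⟩ := exists_isCollapse.{u} hwf
  have hfp := hendX.collapse_eq hpc (isCollapse_val (transClass_coe hVt)) hf
  have hfc : (ZFSet.range f).card ≤ (V_ ξ).card :=
    card_le_of_surjective (A := V_ ξ) f fun b hb => ZFSet.mem_range.1 hb
  have hVc := card_vonNeumann_lt hκ hξ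
  have hfκ := coe_subset_hered hf.isTransitive_range (hfc.trans_lt hVc)
  obtain ⟨T, hT, hfT, hTc, hrefl⟩ := exists_transitive_reflecting (transClass_hered κ)
    hf.isTransitive_range hfκ (hpc.aleph0_le_card hne) hfc (lift_le_mk_hered hκ le_rfl hVc.le)
  have hmem : ∀ x, f x ∈ ZFSet.range f := fun x => ZFSet.mem_range_self x
  -- `T` is small enough to be coded on `V_ξ`, with the value `f x` placed at `⟨x, x⟩`, so its code
  -- is an admissible `Y`.
  obtain ⟨g, hgT, hgs, hgp⟩ := hpc.exists_surjective hTc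
    ⟨_, hfT (hmem ⟨_, hne.choose_spec⟩)⟩ fun x => hfT (hmem x)
  have hg := IsCollapse.of_surjective hT hgT hgs
  have hcg := hg.coextCongr_of_mem
  obtain ⟨Y, hY⟩ := hpc.exists_codedRel_eq fun x y => g x ∈ g y
  rw [← hY] at hg hcg
  obtain ⟨b, c, ys, zs, hb, hc, hzs, hsat⟩ := (hX Y).2.2.2.2 hcg
    (endExt_of_isCollapse hpc hf hg hcg hgp) hg.innerWellFounded
  refine ⟨fun i => ⟨f (ys i), hfκ (hmem _)⟩, ?_⟩
  have h₁ : ∀ i, f (b i) = a i := fun i => hfp _ _ (hb i)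
  have h₂ : (fun i => g (c i)) = a := funext fun i => by rw [hgp _ _ (hc i), h₁]
  have h₃ : (fun i => g (zs i)) = fun i => f (ys i) := funext fun i => hgp _ _ (hzs i)
  have hrange : ZFSet.range g = T := by
    ext t
    rw [ZFSet.mem_range]
    exact ⟨fun ⟨x, hx⟩ => hx ▸ hgT x, hgs t⟩
  rw [hg.sat_iff hcg, h₂, h₃, hrange] at hsat
  exact (hrefl π a _ (fun i => h₁ i ▸ hmem _) fun i => hmem _).1 hsat

theorem sigma2Elementary_of_sigma12Reflection {κ : Cardinal.{u}} (hκ : κ.IsInaccessible)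
    (h : Sigma12Reflection κ) : Sigma2Elementary (hered κ) (hered (Order.succ κ)) := by
  have hsub : hered κ ⊆ hered (Order.succ κ) := hered_mono (Order.le_succ κ)
  refine ⟨hsub, fun n φ hφ a => ?_⟩
  obtain ⟨k, π, hπ, hdef⟩ := hφ.exists_pi1.{u}
  rw [hdef, hdef]
  constructor
  · rintro ⟨xs, H⟩
    exact ⟨fun i => Set.inclusion hsub (xs i),
      hπ.holds_hered_succ hκ (fun i => (a i).2) (fun i => (xs i).2) H⟩
  · rintro ⟨xs, H⟩
    have ha : ∀ i, (a i).1 ∈ V_ κ.ord := fun i =>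
      SetLike.mem_coe.1 (hered_eq_vonNeumann hκ ▸ (a i).2)
    obtain ⟨ξ, hξ, hne, ha', X, hX⟩ := h.exists_lt hκ (predDef_reflectMatrix π) (fun i => (a i).1) ha
      (hπ.exists_reflectMatrix hκ ha (fun i => (xs i).2) H)
    exact exists_holds_of_reflectMatrix hκ hξ hne ha' hX

end LightfaceIndescribable

theorem fact3p2 (κ : Cardinal.{u}) :
    LightfaceIndescribable.IsSigma12Indescribable κ ↔
      κ.IsInaccessible ∧
        LightfaceIndescribable.Sigma2Elementary (LightfaceIndescribable.hered κ)
          (LightfaceIndescribable.hered (Order.succ κ)) :=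
  and_congr_right fun hκ =>
    ⟨LightfaceIndescribable.sigma2Elementary_of_sigma12Reflection hκ,
      LightfaceIndescribable.sigma12Reflection_of_sigma2Elementary hκ⟩
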